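/- Let $k$ be a field and let $\mathcal V=\mathbf{gVect}_{\mathbb Z}$ be the category of $\mathbb Z$-graded $k$-vector spaces and degree-preserving linear maps, with tensor product $(V\otimes W)_n=\bigoplus_{i+j=n}V_i\otimes W_j$, unit $I=k$ concentrated in degree $0$, symmetry $x\otimes y\mapsto(-1)^{ij}\,y\otimes x$ for $x\in V_i$, $y\in W_j$, and internal hom $[V,W]_n=\prod_i\mathrm{Hom}_k(V_i,W_{i+n})$. A graded algebra (coalgebra, bialgebra) is a monoid (comonoid, bimonoid) in $\mathcal V$; a graded algebra is commutative if its multiplication $\mu$ satisfies $\mu c=\mu$, where $c$ is the symmetry. A graded bialgebra $H$ is Hopf if there is a morphism $s\colon H\to H$ with $\mu(s\otimes 1)\Delta=\iota\varepsilon=\mu(1\otimes s)\Delta$, and op-Hopf if there is a morphism $s\colon H\to H$ with $\mu(s\otimes1)c^{-1}\Delta=\iota\varepsilon=\mu(1\otimes s)c^{-1}\Delta$. For a graded coalgebra $C$ and a graded algebra $B$, the object $[C,B]$ is a graded algebra under convolution. A universal measuring coalgebra $P(A,B)$ of graded algebras $A,B$ is a graded coalgebra together with a graded algebra morphism $e\colon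 A\to[P(A,B),B]$ such that, for every graded coalgebra $C$, the assignment $g\mapsto[g,B]\circ e$ is a bijection from graded coalgebra morphisms $C\to P(A,B)$ to graded algebra morphisms $A\to[C,B]$. Let $H$ be a $\mathbb Z$-graded bialgebra and $B$ a commutative $\mathbb Z$-graded algebra. Then a universal measuring coalgebra $P(H,B)$ exists, and for each such $P=P(H,B)$, with $e\colon H\to[P,B]$, there is exactly one graded bialgebra structure on $P$ that extends its coalgebra structure and whose multiplication $m\colon P\otimes P\to P$ and unit $u\colon I\to P$ satisfy $$[m,B]\circ e=\bigl(H\xrightarrow{\Delta}H\otimes H\xrightarrow{e\otimes e}[P,B]\otimes[P,B]\xrightarrow{\chi}[P\otimes P,B]\bigr),\qquad [u,B]\circ e=\bigl(H\xrightarrow{\varepsilon}I\xrightarrow{\chi_0}[I,B]\bigr),$$ where $\chi$ is the tensor product of maps followed by the multiplication of $B$, and $\chi_0$ corresponds to the unit of $B$. If $H$ is Hopf (resp. op-Hopf), then $P(H,B)$ with this bialgebra structure is Hopf (resp. op-Hopf). -/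

import Mathlib

noncomputable section

open CategoryTheory MonoidalCategory

/-! ### The symmetric monoidal closed category of graded vector spaces -/

universe u

/-- The category of `ℤ`-graded vector spaces over `k` and degree-preserving linear maps. It is a
type synonym of a category of graded objects, because its braiding carries the Koszul sign. -/
def GrVect (k : Type u) [Field k] : Type (u + 1) := GradedObject ℤ (ModuleCat.{u} k)

namespace GrVect

variable (k : Type u) [Field k]

instance : Category (GrVect k) :=
  inferInstanceAs (Category (GradedObject ℤ (ModuleCat.{u} k)))

/-- `(V ⊗ W)ₙ = ⨁_{i + j = n} Vᵢ ⊗ Wⱼ`, with unit `k` concentrated in degree `0`. -/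
instance : MonoidalCategory (GrVect k) :=
  inferInstanceAs (MonoidalCategory (GradedObject ℤ (ModuleCat.{u} k)))

variable {k}

@[ext]
lemma hom_ext {X Y : GrVect k} {f g : X ⟶ Y} (h : ∀ n : ℤ, f n = g n) : f = g :=
  funext h

@[simp] lemma id_apply (X : GrVect k) (n : ℤ) : (𝟙 X : X ⟶ X) n = 𝟙 (X n) := rfl

@[simp] lemma comp_apply {X Y Z : GrVect k} (f : X ⟶ Y) (g : Y ⟶ Z) (n : ℤ) :
    (f ≫ g) n = f n ≫ g n := rfl

/-- The inclusion of the summand `Xᵢ ⊗ Yⱼ` into `(X ⊗ Y)ₙ` when `i + j = n`. -/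
def ι (X Y : GrVect k) (i j n : ℤ) (h : i + j = n) :
    MonoidalCategoryStruct.tensorObj (C := ModuleCat.{u} k) (X i) (Y j) ⟶ (X ⊗ Y : GrVect k) n :=
  GradedObject.Monoidal.ιTensorObj (I := ℤ) (C := ModuleCat.{u} k) X Y i j n h

/-- The morphism out of `(X ⊗ Y)ₙ` with given components on the summands `Xᵢ ⊗ Yⱼ`. -/
def desc {X Y : GrVect k} {n : ℤ} {A : ModuleCat.{u} k}
    (f : ∀ (i j : ℤ) (_ : i + j = n),
      MonoidalCategoryStruct.tensorObj (C := ModuleCat.{u} k) (X i) (Y j) ⟶ A) :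
    (X ⊗ Y : GrVect k) n ⟶ A :=
  GradedObject.Monoidal.tensorObjDesc (I := ℤ) (C := ModuleCat.{u} k) (X₁ := X) (X₂ := Y) f

@[simp]
lemma ι_desc {X Y : GrVect k} {n : ℤ} {A : ModuleCat.{u} k}
    (f : ∀ (i j : ℤ) (_ : i + j = n),
      MonoidalCategoryStruct.tensorObj (C := ModuleCat.{u} k) (X i) (Y j) ⟶ A)
    (i j : ℤ) (h : i + j = n) : ι X Y i j n h ≫ desc f = f i j h :=
  GradedObject.Monoidal.ι_tensorObjDesc _ i j h

lemma tensor_ext {X Y : GrVect k} {n : ℤ} {A : ModuleCat.{u} k}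
    {f g : (X ⊗ Y : GrVect k) n ⟶ A}
    (h : ∀ (i j : ℤ) (hij : i + j = n), ι X Y i j n hij ≫ f = ι X Y i j n hij ≫ g) : f = g :=
  GradedObject.Monoidal.tensorObj_ext (I := ℤ) (C := ModuleCat.{u} k) (X₁ := X) (X₂ := Y) f g h

@[simp]
lemma ι_whiskerLeft (X : GrVect k) {Y Y' : GrVect k} (f : Y ⟶ Y') (i j n : ℤ) (h : i + j = n) :
    ι X Y i j n h ≫ (X ◁ f) n = (X i ◁ f j) ≫ ι X Y' i j n h := by
  have := GradedObject.Monoidal.ι_tensorHom (I := ℤ) (C := ModuleCat.{u} k) (𝟙 X) f i j n h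
  exact this.trans (congrArg (· ≫ ι X Y' i j n h) (id_tensorHom (C := ModuleCat.{u} k) (X i) (f j)))

@[simp]
lemma ι_whiskerRight {X X' : GrVect k} (f : X ⟶ X') (Y : GrVect k) (i j n : ℤ) (h : i + j = n) :
    ι X Y i j n h ≫ (f ▷ Y) n = (f i ▷ Y j) ≫ ι X' Y i j n h := by
  have := GradedObject.Monoidal.ι_tensorHom (I := ℤ) (C := ModuleCat.{u} k) f (𝟙 Y) i j n h
  exact this.trans (congrArg (· ≫ ι X' Y i j n h) (tensorHom_id (C := ModuleCat.{u} k) (f i) (Y j)))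

lemma ι_associator_aux (X Y Z : GradedObject ℤ (ModuleCat.{u} k)) (a b c m l n : ℤ)
    (hm : a + b = m) (hl : b + c = l) (hn : m + c = n) (hn' : a + l = n) :
    (GradedObject.Monoidal.ιTensorObj X Y a b m hm ▷ Z c) ≫
        GradedObject.Monoidal.ιTensorObj (GradedObject.Monoidal.tensorObj X Y) Z m c n hn ≫
          (GradedObject.Monoidal.associator X Y Z).hom n =
      (α_ (X a) (Y b) (Z c)).hom ≫ (X a ◁ GradedObject.Monoidal.ιTensorObj Y Z b c l hl) ≫
        GradedObject.Monoidal.ιTensorObj X (GradedObject.Monoidal.tensorObj Y Z) a l n hn' := by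
  have h : a + b + c = n := by rw [hm, hn]
  rw [← GradedObject.Monoidal.ιTensorObj₃_eq X Y Z a b c n h l hl,
    ← GradedObject.Monoidal.ιTensorObj₃'_associator_hom,
    GradedObject.Monoidal.ιTensorObj₃'_eq X Y Z a b c n h m hm, Category.assoc]

lemma ι_associator_hom (X Y Z : GrVect k) (a b c m l n : ℤ) (hm : a + b = m) (hl : b + c = l)
    (hn : m + c = n) (hn' : a + l = n) :
    (ι X Y a b m hm ▷ Z c) ≫ ι (X ⊗ Y) Z m c n hn ≫ (α_ X Y Z).hom n =
      (α_ (X a) (Y b) (Z c)).hom ≫ (X a ◁ ι Y Z b c l hl) ≫ ι X (Y ⊗ Z) a l n hn' :=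
  ι_associator_aux X Y Z a b c m l n hm hl hn hn'

lemma tensor₃_ext_aux {X Y Z : GradedObject ℤ (ModuleCat.{u} k)} {n : ℤ} {A : ModuleCat.{u} k}
    {f g : GradedObject.Monoidal.tensorObj (GradedObject.Monoidal.tensorObj X Y) Z n ⟶ A}
    (h : ∀ (a b c : ℤ) (hn : a + b + c = n),
      (GradedObject.Monoidal.ιTensorObj X Y a b (a + b) rfl ▷ Z c) ≫
        GradedObject.Monoidal.ιTensorObj _ Z (a + b) c n hn ≫ f =
      (GradedObject.Monoidal.ιTensorObj X Y a b (a + b) rfl ▷ Z c) ≫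
        GradedObject.Monoidal.ιTensorObj _ Z (a + b) c n hn ≫ g) : f = g := by
  refine GradedObject.Monoidal.tensorObj₃'_ext f g fun a b c hn => ?_
  rw [GradedObject.Monoidal.ιTensorObj₃'_eq X Y Z a b c n hn _ rfl, Category.assoc, Category.assoc]
  exact h a b c hn

lemma tensor₃_ext {X Y Z : GrVect k} {n : ℤ} {A : ModuleCat.{u} k}
    {f g : ((X ⊗ Y) ⊗ Z : GrVect k) n ⟶ A}
    (h : ∀ (a b c : ℤ) (hn : a + b + c = n),
      (ι X Y a b (a + b) rfl ▷ Z c) ≫ ι (X ⊗ Y) Z (a + b) c n hn ≫ f =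
      (ι X Y a b (a + b) rfl ▷ Z c) ≫ ι (X ⊗ Y) Z (a + b) c n hn ≫ g) : f = g :=
  tensor₃_ext_aux h

/-- `x ⊗ y ↦ (-1)^{ij} y ⊗ x` for `x` of degree `i` and `y` of degree `j`. -/
def koszulHom (X Y : GrVect k) : X ⊗ Y ⟶ Y ⊗ X := fun n =>
  desc fun i j h => (i * j).negOnePow • ((β_ (X i) (Y j)).hom ≫ ι Y X j i n (by omega))

@[simp]
lemma ι_koszulHom (X Y : GrVect k) (i j n : ℤ) (h : i + j = n) :
    ι X Y i j n h ≫ koszulHom X Y n =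
      (i * j).negOnePow • ((β_ (X i) (Y j)).hom ≫ ι Y X j i n (by omega)) :=
  ι_desc _ _ _ _

lemma koszulHom_comp_koszulHom (X Y : GrVect k) :
    koszulHom X Y ≫ koszulHom Y X = 𝟙 (X ⊗ Y) := by
  ext n : 1
  refine tensor_ext fun i j h => ?_
  rw [comp_apply, reassoc_of% ι_koszulHom, Linear.units_smul_comp, Category.assoc, ι_koszulHom,
    Linear.comp_units_smul, smul_smul, mul_comm j i, Int.units_mul_self, one_smul,
    SymmetricCategory.symmetry_assoc]
  exact (Category.comp_id _).symm

lemma whiskerRight_units_smul {M N : ModuleCat.{u} k} (ε : ℤˣ) (f : M ⟶ N) (P : ModuleCat.{u} k) :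
    (ε • f) ▷ P = ε • (f ▷ P) := by
  rcases Int.units_eq_one_or ε with rfl | rfl
  · simp
  · simp only [Units.neg_smul, one_smul]
    exact (tensorRight P).map_neg

lemma whiskerLeft_units_smul {M N : ModuleCat.{u} k} (ε : ℤˣ) (f : M ⟶ N) (P : ModuleCat.{u} k) :
    P ◁ (ε • f) = ε • (P ◁ f) := by
  rcases Int.units_eq_one_or ε with rfl | rfl
  · simp
  · simp only [Units.neg_smul, one_smul]
    exact (tensorLeft P).map_neg

lemma hexagon (X Y Z : GrVect k) :
    (α_ X Y Z).hom ≫ koszulHom X (Y ⊗ Z) ≫ (α_ Y Z X).hom =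
      (koszulHom X Y ▷ Z) ≫ (α_ Y X Z).hom ≫ (Y ◁ koszulHom X Z) := by
  ext n : 1
  refine tensor₃_ext fun a b c h => ?_
  simp only [comp_apply]
  rw [reassoc_of% (ι_associator_hom X Y Z a b c (a + b) (b + c) n rfl rfl h (by omega)),
    reassoc_of% ι_koszulHom, reassoc_of% ι_whiskerRight, ← comp_whiskerRight_assoc, ι_koszulHom]
  simp only [whiskerRight_units_smul, Linear.units_smul_comp, Linear.comp_units_smul,
    comp_whiskerRight, Category.assoc]
  rw [reassoc_of% (ι_associator_hom Y X Z b a c (a + b) (a + c) n (by omega) rfl h (by omega)),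
    ι_whiskerLeft, ← whiskerLeft_comp_assoc, ι_koszulHom]
  simp only [whiskerLeft_units_smul, Linear.units_smul_comp, Linear.comp_units_smul,
    whiskerLeft_comp, Category.assoc, smul_smul]
  rw [mul_add, Int.negOnePow_add, BraidedCategory.braiding_naturality_right_assoc,
    ι_associator_hom Y Z X b c a (b + c) (a + c) n rfl (by omega) (by omega) (by omega),
    BraidedCategory.hexagon_forward_assoc]

/-- The symmetric structure on graded vector spaces given by the Koszul sign rule. -/
instance : SymmetricCategory (GrVect k) where
  braiding X Y :=
    { hom := koszulHom X Y
      inv := koszulHom Y X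
      hom_inv_id := koszulHom_comp_koszulHom X Y
      inv_hom_id := koszulHom_comp_koszulHom Y X }
  braiding_naturality_right X Y Z f := by
    ext n : 1
    refine tensor_ext fun i j h => ?_
    simp [reassoc_of% ι_whiskerLeft, reassoc_of% ι_koszulHom, Linear.comp_units_smul,
      Linear.units_smul_comp]
  braiding_naturality_left f Z := by
    ext n : 1
    refine tensor_ext fun i j h => ?_
    simp [reassoc_of% ι_whiskerRight, reassoc_of% ι_koszulHom, Linear.comp_units_smul,
      Linear.units_smul_comp]
  hexagon_forward X Y Z := hexagon X Y Z
  hexagon_reverse X Y Z := by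
    let b (V W : GrVect k) : V ⊗ W ≅ W ⊗ V :=
      ⟨koszulHom V W, koszulHom W V, koszulHom_comp_koszulHom V W, koszulHom_comp_koszulHom W V⟩
    have h : α_ Z X Y ≪≫ b Z (X ⊗ Y) ≪≫ α_ X Y Z =
        whiskerRightIso (b Z X) Y ≪≫ α_ X Z Y ≪≫ whiskerLeftIso X (b Z Y) :=
      Iso.ext (hexagon Z X Y)
    simpa [b] using congrArg Iso.inv h
  symmetry X Y := koszulHom_comp_koszulHom X Y

/-- The graded internal hom `[X, Z]`, with `[X, Z]ₙ = ∏ᵢ Hom(Xᵢ, Zᵢ₊ₙ)`. -/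
def homObj (X Z : GrVect k) : GrVect k := fun n =>
  ModuleCat.of k (∀ i : ℤ, (X i : ModuleCat.{u} k) →ₗ[k] (Z (i + n) : ModuleCat.{u} k))

/-- The functor `[X, -]`, acting by postcomposition. -/
def homFunctor (X : GrVect k) : GrVect k ⥤ GrVect k where
  obj Z := homObj X Z
  map {Z Z'} f := fun n =>
    ModuleCat.ofHom (X := ∀ i : ℤ, (X i : ModuleCat.{u} k) →ₗ[k] (Z (i + n) : ModuleCat.{u} k))
      (Y := ∀ i : ℤ, (X i : ModuleCat.{u} k) →ₗ[k] (Z' (i + n) : ModuleCat.{u} k))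
      (LinearMap.pi fun i => (LinearMap.compRight k (f (i + n)).hom).comp (LinearMap.proj i))

/-- The transpose `y ↦ (x ↦ f (x ⊗ y))` of `f : X ⊗ Y ⟶ Z`. -/
def curryHom {X Y Z : GrVect k} (f : X ⊗ Y ⟶ Z) : Y ⟶ homObj X Z := fun n =>
  ModuleCat.ofHom (Y := ∀ i : ℤ, (X i : ModuleCat.{u} k) →ₗ[k] (Z (i + n) : ModuleCat.{u} k))
    (LinearMap.pi fun i =>
      (TensorProduct.curry (ι X Y i n (i + n) rfl ≫ f (i + n)).hom).flip)

/-- The morphism `x ⊗ y ↦ g (y) (x)` with transpose `g : Y ⟶ [X, Z]`. -/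
def uncurryHom {X Y Z : GrVect k} (g : Y ⟶ homObj X Z) : X ⊗ Y ⟶ Z := fun _ =>
  desc fun i j h =>
    ModuleCat.ofHom (TensorProduct.lift
      (((LinearMap.proj i :
        (∀ i : ℤ, (X i : ModuleCat.{u} k) →ₗ[k] (Z (i + j) : ModuleCat.{u} k)) →ₗ[k] _).comp
          (g j).hom).flip)) ≫ eqToHom (congrArg Z h)

lemma ι_uncurryHom {X Y Z : GrVect k} (g : Y ⟶ homObj X Z) (i j : ℤ) :
    ι X Y i j (i + j) rfl ≫ uncurryHom g (i + j) = ModuleCat.ofHom (TensorProduct.lift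
      (((LinearMap.proj i :
        (∀ i : ℤ, (X i : ModuleCat.{u} k) →ₗ[k] (Z (i + j) : ModuleCat.{u} k)) →ₗ[k] _).comp
          (g j).hom).flip)) :=
  (ι_desc _ _ _ _).trans (Category.comp_id _)

/-- The bijection `Hom(X ⊗ Y, Z) ≃ Hom(Y, [X, Z])`. -/
def curryEquiv (X Y Z : GrVect k) : (X ⊗ Y ⟶ Z) ≃ (Y ⟶ homObj X Z) where
  toFun := curryHom
  invFun := uncurryHom
  left_inv f := by
    ext n : 1
    refine tensor_ext fun i j h => ?_
    subst h
    rw [ι_uncurryHom]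
    ext : 1
    exact TensorProduct.ext' fun x y => rfl
  right_inv g := by
    ext n : 1
    ext y
    funext i
    ext x
    change (ι X Y i n (i + n) rfl ≫ uncurryHom g (i + n)).hom (x ⊗ₜ y) = _
    rw [ι_uncurryHom]
    rfl

lemma uncurryHom_naturality_left {X Y Y' Z : GrVect k} (f : Y ⟶ Y') (g : Y' ⟶ homObj X Z) :
    uncurryHom (f ≫ g) = X ◁ f ≫ uncurryHom g := by
  ext n : 1
  refine tensor_ext fun i j h => ?_
  subst h
  rw [comp_apply, reassoc_of% ι_whiskerLeft, ι_uncurryHom, ι_uncurryHom]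
  ext : 1
  exact TensorProduct.ext' fun x y => rfl

/-- The adjunction `X ⊗ - ⊣ [X, -]`. -/
def homAdjunction (X : GrVect k) : tensorLeft X ⊣ homFunctor X :=
  Adjunction.mkOfHomEquiv
    { homEquiv := fun Y Z => curryEquiv X Y Z
      homEquiv_naturality_left_symm := fun f g => uncurryHom_naturality_left f g
      homEquiv_naturality_right := fun _ _ => rfl }

instance : MonoidalClosed (GrVect k) where
  closed X :=
    { rightAdj := homFunctor X
      adj := homAdjunction X }

end GrVect

/-! ### Convolution monoids and universal measuring comonoids -/

namespace Measuring

open MonoidalClosed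
open scoped MonObj ComonObj

universe v w

variable {V : Type w} [Category.{v} V] [MonoidalCategory V]

section

variable [BraidedCategory V] {C B : V} [ComonObj C] [MonObj B]

/-- The convolution product of `a : C ⊗ W ⟶ B` and `b : C ⊗ W' ⟶ B`. -/
def convProd {W W' : V} (a : C ⊗ W ⟶ B) (b : C ⊗ W' ⟶ B) : C ⊗ (W ⊗ W') ⟶ B :=
  Δ[C] ▷ (W ⊗ W') ≫ tensorμ C C W W' ≫ (a ⊗ₘ b) ≫ μ[B]

lemma convProd_assoc {W W' W'' : V} (a : C ⊗ W ⟶ B) (b : C ⊗ W' ⟶ B) (c : C ⊗ W'' ⟶ B) :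
    convProd (convProd a b) c = C ◁ (α_ W W' W'').hom ≫ convProd a (convProd b c) := by
  have h1 : convProd (convProd a b) c =
      (Δ[C] ≫ Δ[C] ▷ C) ▷ ((W ⊗ W') ⊗ W'') ≫ tensorμ (C ⊗ C) C (W ⊗ W') W'' ≫
        tensorμ C C W W' ▷ (C ⊗ W'') ≫ (((a ⊗ₘ b) ≫ μ[B]) ⊗ₘ c) ≫ μ[B] := by
    have h : convProd a b ⊗ₘ c = (Δ[C] ▷ (W ⊗ W') ⊗ₘ 𝟙 C ▷ W'') ≫
        tensorμ C C W W' ▷ (C ⊗ W'') ≫ (((a ⊗ₘ b) ≫ μ[B]) ⊗ₘ c) := by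
      rw [← tensorHom_id (tensorμ C C W W'), tensorHom_comp_tensorHom,
        tensorHom_comp_tensorHom, id_whiskerRight, Category.id_comp, Category.id_comp, convProd]
    rw [convProd, h, Category.assoc, Category.assoc, ← tensorμ_natural_left_assoc, tensorHom_id,
      ← comp_whiskerRight_assoc]
  have h2 : convProd a (convProd b c) =
      (Δ[C] ≫ C ◁ Δ[C]) ▷ (W ⊗ (W' ⊗ W'')) ≫ tensorμ C (C ⊗ C) W (W' ⊗ W'') ≫
        (C ⊗ W) ◁ tensorμ C C W' W'' ≫ (a ⊗ₘ ((b ⊗ₘ c) ≫ μ[B])) ≫ μ[B] := by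
    have h : a ⊗ₘ convProd b c = (𝟙 C ▷ W ⊗ₘ Δ[C] ▷ (W' ⊗ W'')) ≫
        (C ⊗ W) ◁ tensorμ C C W' W'' ≫ (a ⊗ₘ ((b ⊗ₘ c) ≫ μ[B])) := by
      rw [← id_tensorHom (C ⊗ W), tensorHom_comp_tensorHom,
        tensorHom_comp_tensorHom, id_whiskerRight, Category.id_comp, Category.id_comp, convProd]
    rw [convProd, h, Category.assoc, Category.assoc, ← tensorμ_natural_left_assoc, id_tensorHom,
      ← comp_whiskerRight_assoc]
  have h3 : (((a ⊗ₘ b) ≫ μ[B]) ⊗ₘ c) ≫ μ[B] =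
      (α_ _ _ _).hom ≫ (a ⊗ₘ ((b ⊗ₘ c) ≫ μ[B])) ≫ μ[B] := by
    have e1 : ((a ⊗ₘ b) ≫ μ[B]) ⊗ₘ c = ((a ⊗ₘ b) ⊗ₘ c) ≫ μ[B] ▷ B := by
      rw [← tensorHom_id, tensorHom_comp_tensorHom, Category.comp_id]
    have e2 : a ⊗ₘ ((b ⊗ₘ c) ≫ μ[B]) = (a ⊗ₘ (b ⊗ₘ c)) ≫ B ◁ μ[B] := by
      rw [← id_tensorHom, tensorHom_comp_tensorHom, Category.comp_id]
    rw [e1, e2, Category.assoc, Category.assoc, MonObj.mul_assoc, associator_naturality_assoc]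
  rw [h1, h2, h3, associator_monoidal_assoc, whisker_exchange_assoc, tensorHom_def_assoc,
    ← comp_whiskerRight_assoc, Category.assoc, ComonObj.comul_assoc]

lemma one_convProd {W : V} (a : C ⊗ W ⟶ B) :
    convProd (ε[C] ▷ 𝟙_ V ≫ (λ_ (𝟙_ V)).hom ≫ η[B]) a = C ◁ (λ_ W).hom ≫ a := by
  have h : (ε[C] ▷ 𝟙_ V ≫ (λ_ (𝟙_ V)).hom ≫ η[B]) ⊗ₘ a =
      (ε[C] ▷ 𝟙_ V ⊗ₘ 𝟙 C ▷ W) ≫ (λ_ (𝟙_ V)).hom ▷ (C ⊗ W) ≫ 𝟙_ V ◁ a ≫ η[B] ▷ B := by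
    rw [← tensorHom_id (λ_ (𝟙_ V)).hom, ← tensorHom_id η[B], ← id_tensorHom,
      tensorHom_comp_tensorHom, tensorHom_comp_tensorHom, tensorHom_comp_tensorHom]
    simp
  rw [convProd, h, Category.assoc, Category.assoc, Category.assoc, ← tensorμ_natural_left_assoc,
    MonObj.one_mul, leftUnitor_naturality, ← leftUnitor_monoidal_assoc, tensorHom_id,
    ← comp_whiskerRight_assoc, ComonObj.counit_comul, tensorHom_def_assoc,
    ← comp_whiskerRight_assoc, Iso.inv_hom_id, id_whiskerRight, Category.id_comp]

lemma convProd_one {W : V} (a : C ⊗ W ⟶ B) :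
    convProd a (ε[C] ▷ 𝟙_ V ≫ (λ_ (𝟙_ V)).hom ≫ η[B]) = C ◁ (ρ_ W).hom ≫ a := by
  have h : a ⊗ₘ (ε[C] ▷ 𝟙_ V ≫ (λ_ (𝟙_ V)).hom ≫ η[B]) =
      (𝟙 C ▷ W ⊗ₘ ε[C] ▷ 𝟙_ V) ≫ (C ⊗ W) ◁ (λ_ (𝟙_ V)).hom ≫ a ▷ 𝟙_ V ≫ B ◁ η[B] := by
    rw [← tensorHom_id a, ← id_tensorHom, ← id_tensorHom, tensorHom_comp_tensorHom,
      tensorHom_comp_tensorHom, tensorHom_comp_tensorHom]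
    simp
  rw [convProd, h, Category.assoc, Category.assoc, Category.assoc, ← tensorμ_natural_left_assoc,
    MonObj.mul_one, rightUnitor_naturality, ← rightUnitor_monoidal_assoc, id_tensorHom,
    ← comp_whiskerRight_assoc, ComonObj.comul_counit, tensorHom_def_assoc,
    ← comp_whiskerRight_assoc, Iso.inv_hom_id, id_whiskerRight, Category.id_comp]

end

variable [MonoidalClosed V]

/-- The morphism `[X, B] ⊗ [Y, B] ⟶ [X ⊗ Y, B]`, sending `f ⊗ g` to the composite of `f ⊗ g`
with the multiplication of `B`. -/
def homTensor [BraidedCategory V] (X Y B : V) [MonObj B] :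
    (ihom X).obj B ⊗ (ihom Y).obj B ⟶ (ihom (X ⊗ Y)).obj B :=
  curry (tensorμ X Y ((ihom X).obj B) ((ihom Y).obj B) ≫
    ((ihom.ev X).app B ⊗ₘ (ihom.ev Y).app B) ≫ μ[B])

/-- The morphism `I ⟶ [I, B]` corresponding to the unit of `B`. -/
def homUnit (B : V) [MonObj B] : 𝟙_ V ⟶ (ihom (𝟙_ V)).obj B :=
  curry ((λ_ (𝟙_ V)).hom ≫ η[B])

lemma uncurry_convOne {C B : V} [ComonObj C] [MonObj B] : uncurry (homUnit B ≫ (pre ε[C]).app B) =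
    ε[C] ▷ 𝟙_ V ≫ (λ_ (𝟙_ V)).hom ≫ η[B] := by
  rw [uncurry_pre_app, homUnit, uncurry_curry]

variable [BraidedCategory V]

lemma uncurry_convMul {C B W W' : V} [ComonObj C] [MonObj B]
    (f : W ⟶ (ihom C).obj B) (g : W' ⟶ (ihom C).obj B) :
    uncurry ((f ⊗ₘ g) ≫ homTensor C C B ≫ (pre Δ[C]).app B) =
      convProd (uncurry f) (uncurry g) := by
  rw [← Category.assoc, uncurry_pre_app, uncurry_natural_left, homTensor, uncurry_curry,
    tensorμ_natural_right_assoc, tensorHom_comp_tensorHom_assoc, convProd, uncurry_eq, uncurry_eq]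

/-- The convolution monoid structure on `[C, B]`, for a comonoid `C` and a monoid `B`. -/
@[reducible] def convMonObj (C B : V) [ComonObj C] [MonObj B] : MonObj ((ihom C).obj B) where
  one := homUnit B ≫ (pre ε[C]).app B
  mul := homTensor C C B ≫ (pre Δ[C]).app B
  one_mul := by
    apply uncurry_injective
    rw [← tensorHom_id, uncurry_convMul, uncurry_convOne, one_convProd,
      ← uncurry_natural_left, Category.comp_id]
  mul_one := by
    apply uncurry_injective
    rw [← id_tensorHom, uncurry_convMul, uncurry_convOne, convProd_one,
      ← uncurry_natural_left, Category.comp_id]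
  mul_assoc := by
    apply uncurry_injective
    have h : uncurry (homTensor C C B ≫ (pre Δ[C]).app B) =
        convProd (uncurry (𝟙 ((ihom C).obj B))) (uncurry (𝟙 ((ihom C).obj B))) := by
      rw [← uncurry_convMul, id_tensorHom_id, Category.id_comp]
    rw [← tensorHom_id, uncurry_convMul, h, convProd_assoc, uncurry_natural_left,
      ← id_tensorHom ((ihom C).obj B), uncurry_convMul, h]

attribute [local instance] convMonObj

/-- `P` together with `e : A ⟶ [P, B]` is a universal measuring comonoid `P(A, B)`: the morphism
`e` is a morphism of monoids, and composition with it is, for every comonoid `C`, a bijection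
from comonoid morphisms `C ⟶ P` to monoid morphisms `A ⟶ [C, B]`. -/
structure IsUniversal (A B P : V) [MonObj A] [MonObj B] [ComonObj P]
    (e : A ⟶ (ihom P).obj B) : Prop where
  isMonHom : IsMonHom e
  existsUnique : ∀ (C : V) [ComonObj C] (f : A ⟶ (ihom C).obj B), IsMonHom f →
    ∃! g : C ⟶ P, IsComonHom g ∧ e ≫ (pre g).app B = f

/-- The bimonoid structure `b` on `P = P(H, B)` is the one induced by the bimonoid `H` and the
commutative monoid `B`: its comonoid structure is that of `P`; its multiplication `P ⊗ P ⟶ P` has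
transpose `H ⟶ [P ⊗ P, B]` equal to `H ⟶ H ⊗ H ⟶ [P, B] ⊗ [P, B] ⟶ [P ⊗ P, B]`; and its unit
`I ⟶ P` has transpose `H ⟶ [I, B]` equal to `H ⟶ I ⟶ [I, B]`. -/
structure IsInducedBimonoid (H B P : V) [ComonObj H] [MonObj B] [cP : ComonObj P]
    (e : H ⟶ (ihom P).obj B) (b : BimonObj P) : Prop where
  toComonObj_eq : b.toComonObj = cP
  one_comp : e ≫ (pre b.one).app B = ε[H] ≫ homUnit B
  mul_comp : e ≫ (pre b.mul).app B = Δ[H] ≫ (e ⊗ₘ e) ≫ homTensor P P B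

/-- A bimonoid is Hopf if it has an antipode. -/
def IsHopf (H : V) [BimonObj H] : Prop :=
  ∃ s : H ⟶ H, Δ[H] ≫ s ▷ H ≫ μ[H] = ε[H] ≫ η[H] ∧ Δ[H] ≫ H ◁ s ≫ μ[H] = ε[H] ≫ η[H]

/-- A bimonoid is op-Hopf if it has an opantipode: a convolution inverse of the identity with
respect to the opposite comultiplication. -/
def IsOpHopf (H : V) [BimonObj H] : Prop :=
  ∃ s : H ⟶ H, Δ[H] ≫ (β_ H H).inv ≫ s ▷ H ≫ μ[H] = ε[H] ≫ η[H] ∧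
    Δ[H] ≫ (β_ H H).inv ≫ H ◁ s ≫ μ[H] = ε[H] ≫ η[H]

end Measuring

end

noncomputable section

open CategoryTheory MonoidalCategory MonoidalClosed
open scoped MonObj ComonObj

namespace Measuring

universe v w

/-! ### Pairings and the symmetry of the interchange morphism -/

section Pairing

variable {V : Type w} [Category.{v} V] [MonoidalCategory V]

/-! Transposing `A ⟶ [C, B]` to `C ⊗ A ⟶ B` turns algebra morphisms into measurings, and `P(A, B)`
becomes a terminal object among coalgebras equipped with a measuring from `A` to `B`. Write a
measuring as `a(c, h)`.

Bimonoid structure. If `H` is a bimonoid and `B` is commutative, then `(c ⊗ c', h) ↦ a(c, h₁) a'(c',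
h₂)` is again a measuring (`isMeasuring_measProd`): `Δ` is multiplicative on `H`, and commutativity
of `B` permits the exchange of the two middle factors. With `a = a'` the universal measuring, the
universal property yields the multiplication of `P`; the measuring `ε` followed by `η` yields the
unit. Both are comonoid morphisms, and the remaining axioms are equalities of comonoid morphisms
into `P`, hence can be tested on `a`.

Antipode. If `s` is an antipode of `H`, it reverses products, so `a(p, s h)` is a measuring on `P`
with opposite comultiplication and is classified by some `f : P ⟶ P`. The convolution `f * id` and
`ηε` agree after pairing with `H`, but `f * id` is not known to be a comonoid morphism, so
uniqueness does not apply directly. Instead their coequalizer is shown to inherit the comonoid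
structure and the measuring (`comul_antipode_left`, `comul_antipode_right`); universality of `P`
then makes the quotient map split mono, which forces equality. The op-Hopf case is the Hopf case for
`H` with opposite comultiplication, which induces the opposite multiplication on the same `P`.

Existence. Every homogeneous element of a graded coalgebra lies in a subcoalgebra of countable
dimension in each degree (`exists_countable_subcomonoid`), so up to isomorphism a set of measuring
coalgebras reaches all elements of all others. The coproduct of this set, divided by the sum of all
kernels of its quotients, is terminal (`exists_isUniversalMeasuring`). -/

/-- The triple `(f, g, h)` is a morphism from the pairing `m` to the pairing `m'`. -/
def PairingHom {X Y Z X' Y' Z' : V} (m : X ⊗ Y ⟶ Z) (m' : X' ⊗ Y' ⟶ Z')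
    (f : X ⟶ X') (g : Y ⟶ Y') (h : Z ⟶ Z') : Prop :=
  (f ⊗ₘ g) ≫ m' = m ≫ h

namespace PairingHom

lemma id {X Y Z : V} (m : X ⊗ Y ⟶ Z) : PairingHom m m (𝟙 X) (𝟙 Y) (𝟙 Z) := by
  simp [PairingHom]

lemma comp {X Y Z X' Y' Z' X'' Y'' Z'' : V} {m : X ⊗ Y ⟶ Z} {m' : X' ⊗ Y' ⟶ Z'}
    {m'' : X'' ⊗ Y'' ⟶ Z''} {f : X ⟶ X'} {g : Y ⟶ Y'} {h : Z ⟶ Z'} {f' : X' ⟶ X''}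
    {g' : Y' ⟶ Y''} {h' : Z' ⟶ Z''} (s : PairingHom m m' f g h) (s' : PairingHom m' m'' f' g' h') :
    PairingHom m m'' (f ≫ f') (g ≫ g') (h ≫ h') := by
  rw [PairingHom] at *
  rw [← tensorHom_comp_tensorHom, Category.assoc, s', reassoc_of% s]

lemma symm {X Y Z X' Y' Z' : V} {m : X ⊗ Y ⟶ Z} {m' : X' ⊗ Y' ⟶ Z'}
    {f : X ≅ X'} {g : Y ≅ Y'} {h : Z ≅ Z'} (s : PairingHom m m' f.hom g.hom h.hom) :
    PairingHom m' m f.inv g.inv h.inv := by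
  rw [PairingHom] at *
  rw [← cancel_epi (f.hom ⊗ₘ g.hom), ← cancel_mono h.hom]
  simp [s]

end PairingHom

section

variable [BraidedCategory V]

/-- The tensor product of two pairings. -/
def tensorPairing {X Y Z X' Y' Z' : V} (m : X ⊗ Y ⟶ Z) (m' : X' ⊗ Y' ⟶ Z') :
    (X ⊗ X') ⊗ (Y ⊗ Y') ⟶ Z ⊗ Z' :=
  tensorμ X X' Y Y' ≫ (m ⊗ₘ m')

namespace PairingHom

lemma tensor {X₁ Y₁ Z₁ X₁' Y₁' Z₁' X₂ Y₂ Z₂ X₂' Y₂' Z₂' : V}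
    {m₁ : X₁ ⊗ Y₁ ⟶ Z₁} {m₁' : X₁' ⊗ Y₁' ⟶ Z₁'} {m₂ : X₂ ⊗ Y₂ ⟶ Z₂} {m₂' : X₂' ⊗ Y₂' ⟶ Z₂'}
    {f₁ : X₁ ⟶ X₁'} {g₁ : Y₁ ⟶ Y₁'} {h₁ : Z₁ ⟶ Z₁'} {f₂ : X₂ ⟶ X₂'} {g₂ : Y₂ ⟶ Y₂'}
    {h₂ : Z₂ ⟶ Z₂'} (s₁ : PairingHom m₁ m₁' f₁ g₁ h₁) (s₂ : PairingHom m₂ m₂' f₂ g₂ h₂) :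
    PairingHom (tensorPairing m₁ m₂) (tensorPairing m₁' m₂') (f₁ ⊗ₘ f₂) (g₁ ⊗ₘ g₂)
      (h₁ ⊗ₘ h₂) := by
  rw [PairingHom] at *
  rw [tensorPairing, tensorPairing, tensorμ_natural_assoc, Category.assoc, tensorHom_comp_tensorHom,
    tensorHom_comp_tensorHom, s₁, s₂]

lemma associator {X₁ Y₁ Z₁ X₂ Y₂ Z₂ X₃ Y₃ Z₃ : V}
    (m₁ : X₁ ⊗ Y₁ ⟶ Z₁) (m₂ : X₂ ⊗ Y₂ ⟶ Z₂) (m₃ : X₃ ⊗ Y₃ ⟶ Z₃) :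
    PairingHom (tensorPairing (tensorPairing m₁ m₂) m₃) (tensorPairing m₁ (tensorPairing m₂ m₃))
      (α_ _ _ _).hom (α_ _ _ _).hom (α_ _ _ _).hom := by
  have h1 : tensorPairing (tensorPairing m₁ m₂) m₃ =
      tensorμ (X₁ ⊗ X₂) X₃ (Y₁ ⊗ Y₂) Y₃ ≫ tensorμ X₁ X₂ Y₁ Y₂ ▷ (X₃ ⊗ Y₃) ≫
        ((m₁ ⊗ₘ m₂) ⊗ₘ m₃) := by
    rw [tensorPairing, tensorPairing, ← tensorHom_id, tensorHom_comp_tensorHom, Category.id_comp]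
  have h2 : tensorPairing m₁ (tensorPairing m₂ m₃) =
      tensorμ X₁ (X₂ ⊗ X₃) Y₁ (Y₂ ⊗ Y₃) ≫ (X₁ ⊗ Y₁) ◁ tensorμ X₂ X₃ Y₂ Y₃ ≫
        (m₁ ⊗ₘ (m₂ ⊗ₘ m₃)) := by
    rw [tensorPairing, tensorPairing, ← id_tensorHom, tensorHom_comp_tensorHom, Category.id_comp]
  rw [PairingHom, h1, h2, ← associator_monoidal_assoc]
  simp

end PairingHom

end

section

variable [SymmetricCategory V]

/-- On the left `X₂` and `Y₁` cross twice, on the right not at all; the double crossing cancels only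
because the braiding is symmetric. -/
lemma tensorμ_braiding (X₁ X₂ Y₁ Y₂ : V) :
    tensorμ X₁ X₂ Y₁ Y₂ ≫ (β_ (X₁ ⊗ Y₁) (X₂ ⊗ Y₂)).hom =
      ((β_ X₁ X₂).hom ⊗ₘ (β_ Y₁ Y₂).hom) ≫ tensorμ X₂ X₁ Y₂ Y₁ := by
  simp [tensorμ, SymmetricCategory.braiding_swap_eq_inv_braiding X₂ Y₁,
    MonoidalCategory.tensorHom_def]

namespace PairingHom

lemma braiding {X₁ Y₁ Z₁ X₂ Y₂ Z₂ : V} (m₁ : X₁ ⊗ Y₁ ⟶ Z₁) (m₂ : X₂ ⊗ Y₂ ⟶ Z₂) :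
    PairingHom (tensorPairing m₁ m₂) (tensorPairing m₂ m₁)
      (β_ _ _).hom (β_ _ _).hom (β_ _ _).hom := by
  rw [PairingHom, tensorPairing, tensorPairing, ← reassoc_of% tensorμ_braiding, Category.assoc,
    BraidedCategory.braiding_naturality]

/-- The interchange is built from associators and one braiding, each of which is a morphism of
pairings. -/
lemma tensorμ {X₁ Y₁ Z₁ X₂ Y₂ Z₂ X₃ Y₃ Z₃ X₄ Y₄ Z₄ : V} (m₁ : X₁ ⊗ Y₁ ⟶ Z₁)
    (m₂ : X₂ ⊗ Y₂ ⟶ Z₂) (m₃ : X₃ ⊗ Y₃ ⟶ Z₃) (m₄ : X₄ ⊗ Y₄ ⟶ Z₄) :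
    PairingHom (tensorPairing (tensorPairing m₁ m₂) (tensorPairing m₃ m₄))
      (tensorPairing (tensorPairing m₁ m₃) (tensorPairing m₂ m₄))
      (MonoidalCategory.tensorμ X₁ X₂ X₃ X₄) (MonoidalCategory.tensorμ Y₁ Y₂ Y₃ Y₄)
      (MonoidalCategory.tensorμ Z₁ Z₂ Z₃ Z₄) := by
  have := (associator m₁ m₂ (tensorPairing m₃ m₄)).comp <|
    ((PairingHom.id m₁).tensor <| (associator m₂ m₃ m₄).symm.comp <|
      ((braiding m₂ m₃).tensor (PairingHom.id m₄)).comp (associator m₃ m₂ m₄)).comp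
    (associator m₁ m₃ (tensorPairing m₂ m₄)).symm
  simpa only [MonoidalCategory.tensorμ, id_tensorHom, tensorHom_id, whiskerLeft_comp,
    Category.assoc] using this

end PairingHom

end

end Pairing

/-! ### Measurings -/

attribute [local instance] convMonObj ComonObj.instTensorUnit

section Naturality

variable {V : Type w} [Category.{v} V] [MonoidalCategory V] [BraidedCategory V]

lemma tensorPairing_comp {X Y Z W X' Y' Z' W' : V} (m : X ⊗ Y ⟶ Z) (m' : X' ⊗ Y' ⟶ Z')
    (h : Z ⟶ W) (h' : Z' ⟶ W') :
    tensorPairing (m ≫ h) (m' ≫ h') = tensorPairing m m' ≫ (h ⊗ₘ h') := by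
  rw [tensorPairing, tensorPairing, Category.assoc, tensorHom_comp_tensorHom]

lemma whiskerRight_tensorPairing {X Y Z X' Y' Z' W W' : V} (f : W ⟶ X) (f' : W' ⟶ X')
    (m : X ⊗ Y ⟶ Z) (m' : X' ⊗ Y' ⟶ Z') :
    (f ⊗ₘ f') ▷ (Y ⊗ Y') ≫ tensorPairing m m' = tensorPairing (f ▷ Y ≫ m) (f' ▷ Y' ≫ m') := by
  rw [tensorPairing, tensorPairing, tensorμ_natural_left_assoc, tensorHom_comp_tensorHom]

lemma whiskerLeft_tensorPairing {X Y Z X' Y' Z' W W' : V} (g : W ⟶ Y) (g' : W' ⟶ Y')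
    (m : X ⊗ Y ⟶ Z) (m' : X' ⊗ Y' ⟶ Z') :
    (X ⊗ X') ◁ (g ⊗ₘ g') ≫ tensorPairing m m' = tensorPairing (X ◁ g ≫ m) (X' ◁ g' ≫ m') := by
  rw [tensorPairing, tensorPairing, tensorμ_natural_right_assoc, tensorHom_comp_tensorHom]

variable {C C' C'' D D' A B H W W' : V} [ComonObj C] [ComonObj C'] [ComonObj C''] [ComonObj D]
  [ComonObj D'] [ComonObj H] [MonObj A] [MonObj B]

lemma convProd_eq (a : C ⊗ W ⟶ B) (b : C ⊗ W' ⟶ B) :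
    convProd a b = Δ[C] ▷ (W ⊗ W') ≫ tensorPairing a b ≫ μ[B] := by
  rw [convProd, tensorPairing, Category.assoc]

lemma whiskerRight_convProd (f : D ⟶ C) [IsComonHom f] (a : C ⊗ W ⟶ B) (b : C ⊗ W' ⟶ B) :
    f ▷ (W ⊗ W') ≫ convProd a b = convProd (f ▷ W ≫ a) (f ▷ W' ≫ b) := by
  rw [convProd_eq, convProd_eq, ← comp_whiskerRight_assoc, IsComonHom.hom_comul,
    comp_whiskerRight_assoc, reassoc_of% whiskerRight_tensorPairing]

lemma whiskerLeft_convProd {X X' : V} (g : X ⟶ W) (g' : X' ⟶ W') (a : C ⊗ W ⟶ B)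
    (b : C ⊗ W' ⟶ B) :
    C ◁ (g ⊗ₘ g') ≫ convProd a b = convProd (C ◁ g ≫ a) (C ◁ g' ≫ b) := by
  rw [convProd_eq, convProd_eq, whisker_exchange_assoc, reassoc_of% whiskerLeft_tensorPairing]

/-- A morphism `C ⊗ A ⟶ B` is a measuring if it respects the monoid structures of `A` and `B`
along the comonoid structure of `C`. -/
structure IsMeasuring (a : C ⊗ A ⟶ B) : Prop where
  one : C ◁ η[A] ≫ a = ε[C] ▷ 𝟙_ V ≫ (λ_ (𝟙_ V)).hom ≫ η[B]
  mul : C ◁ μ[A] ≫ a = convProd a a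

lemma IsMeasuring.precomp {a : C ⊗ A ⟶ B} (ha : IsMeasuring a) (f : D ⟶ C) [IsComonHom f] :
    IsMeasuring (f ▷ A ≫ a) where
  one := by
    rw [whisker_exchange_assoc, ha.one, ← comp_whiskerRight_assoc, IsComonHom.hom_counit]
  mul := by
    rw [whisker_exchange_assoc, ha.mul, whiskerRight_convProd]

/-- The product `(c ⊗ c') ⊗ h ↦ a (c ⊗ h₁) * b (c' ⊗ h₂)`. -/
def measProd (a : W ⊗ H ⟶ B) (b : W' ⊗ H ⟶ B) : (W ⊗ W') ⊗ H ⟶ B :=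
  (W ⊗ W') ◁ Δ[H] ≫ tensorPairing a b ≫ μ[B]

lemma whiskerRight_measProd {X X' : V} (f : X ⟶ W) (f' : X' ⟶ W') (a : W ⊗ H ⟶ B)
    (b : W' ⊗ H ⟶ B) :
    (f ⊗ₘ f') ▷ H ≫ measProd a b = measProd (f ▷ H ≫ a) (f' ▷ H ≫ b) := by
  rw [measProd, measProd, ← whisker_exchange_assoc, reassoc_of% whiskerRight_tensorPairing]

/-- Coassociativity of `H` and associativity of `B`; the three factors need not be measurings. This
becomes associativity of the multiplication of `P`. -/
lemma measProd_assoc {W'' : V} (a : W ⊗ H ⟶ B) (b : W' ⊗ H ⟶ B) (c : W'' ⊗ H ⟶ B) :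
    measProd (measProd a b) c = (α_ W W' W'').hom ▷ H ≫ measProd a (measProd b c) := by
  have h1 : measProd (measProd a b) c = ((W ⊗ W') ⊗ W'') ◁ (Δ[H] ≫ Δ[H] ▷ H) ≫
      tensorPairing (tensorPairing a b) c ≫ μ[B] ▷ B ≫ μ[B] := by
    have := whiskerLeft_tensorPairing Δ[H] (𝟙 H) (tensorPairing a b ≫ μ[B]) c
    rw [tensorHom_id, whiskerLeft_id, Category.id_comp, ← measProd] at this
    rw [measProd, ← this, ← Category.comp_id c, tensorPairing_comp, tensorHom_id, Category.comp_id]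
    simp
  have h2 : measProd a (measProd b c) = (W ⊗ (W' ⊗ W'')) ◁ (Δ[H] ≫ H ◁ Δ[H]) ≫
      tensorPairing a (tensorPairing b c) ≫ B ◁ μ[B] ≫ μ[B] := by
    have := whiskerLeft_tensorPairing (𝟙 H) Δ[H] a (tensorPairing b c ≫ μ[B])
    rw [id_tensorHom, whiskerLeft_id, Category.id_comp, ← measProd] at this
    rw [measProd, ← this, ← Category.comp_id a, tensorPairing_comp, id_tensorHom, Category.comp_id]
    simp only [whiskerLeft_comp, Category.assoc]
  have h3 := PairingHom.associator a b c
  rw [PairingHom, MonoidalCategory.tensorHom_def'] at h3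
  rw [h1, h2, MonObj.mul_assoc, ← reassoc_of% h3, ← whisker_exchange_assoc,
    ← whiskerLeft_comp_assoc, Category.assoc, ComonObj.comul_assoc]

lemma one_measProd (a : W ⊗ H ⟶ B) :
    measProd ((λ_ H).hom ≫ ε[H] ≫ η[B]) a = (λ_ W).hom ▷ H ≫ a := by
  have := whiskerLeft_tensorPairing ε[H] (𝟙 H) ((λ_ (𝟙_ V)).hom ≫ η[B]) (a ≫ 𝟙 B)
  rw [tensorHom_id, whiskerLeft_id, Category.id_comp, leftUnitor_naturality_assoc,
    Category.comp_id] at this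
  rw [measProd, ← this, ← Category.comp_id a, tensorPairing_comp, tensorHom_id, Category.assoc,
    Category.assoc, MonObj.one_mul, ← whiskerLeft_comp_assoc, ComonObj.counit_comul, tensorPairing,
    Category.assoc, MonoidalCategory.tensorHom_def, Category.assoc, leftUnitor_naturality,
    ← leftUnitor_monoidal_assoc, MonoidalCategory.tensorHom_def', Category.assoc,
    ← whiskerLeft_comp_assoc, Iso.inv_hom_id, whiskerLeft_id, Category.id_comp, Category.comp_id]

lemma measProd_one (a : W ⊗ H ⟶ B) :
    measProd a ((λ_ H).hom ≫ ε[H] ≫ η[B]) = (ρ_ W).hom ▷ H ≫ a := by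
  have := whiskerLeft_tensorPairing (𝟙 H) ε[H] (a ≫ 𝟙 B) ((λ_ (𝟙_ V)).hom ≫ η[B])
  rw [id_tensorHom, whiskerLeft_id, Category.id_comp, leftUnitor_naturality_assoc,
    Category.comp_id] at this
  rw [measProd, ← this, ← Category.comp_id a, tensorPairing_comp, id_tensorHom, Category.assoc,
    Category.assoc, MonObj.mul_one, ← whiskerLeft_comp_assoc, ComonObj.comul_counit, tensorPairing,
    Category.assoc, MonoidalCategory.tensorHom_def', Category.assoc, rightUnitor_naturality,
    ← rightUnitor_monoidal_assoc, MonoidalCategory.tensorHom_def', Category.assoc,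
    ← whiskerLeft_comp_assoc, Iso.inv_hom_id, whiskerLeft_id, Category.id_comp, Category.comp_id]

end Naturality

/-! ### Structural morphisms between tensor products of comonoids -/

section TensorComon

variable {V : Type w} [Category.{v} V] [MonoidalCategory V] [BraidedCategory V]
  {C D E : V} [ComonObj C] [ComonObj D] [ComonObj E]

lemma isComonHom_whiskerRight (f : C ⟶ D) [IsComonHom f] : IsComonHom (f ▷ E) :=
  inferInstanceAs
    (IsComonHom (Comon.Hom.mk (M := Comon.mk C) (N := Comon.mk D) f ▷ Comon.mk E).hom)

lemma isComonHom_whiskerLeft (f : C ⟶ D) [IsComonHom f] : IsComonHom (E ◁ f) :=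
  inferInstanceAs
    (IsComonHom (Comon.mk E ◁ Comon.Hom.mk (M := Comon.mk C) (N := Comon.mk D) f).hom)

lemma isComonHom_associator : IsComonHom (α_ C D E).hom := by
  have e : (α_ (Comon.mk C) (Comon.mk D) (Comon.mk E)).hom.hom = (α_ C D E).hom := by
    rw [Comon.monoidal_associator_hom_hom]
    exact (congrArg₂ (· ≫ ·) (id_whiskerRight _ _)
      (congrArg₂ (· ≫ ·) rfl (whiskerLeft_id _ _))).trans (by simp)
  rw [← e]
  exact Comon.Hom.isComonHom_hom _

lemma isComonHom_leftUnitor : IsComonHom (λ_ C).hom where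
  hom_counit := by simp
  hom_comul := by
    rw [Comon.tensorObj_comul, ComonObj.instTensorUnit_comul, MonoidalCategory.tensorHom_def',
      Category.assoc, Category.assoc, ← tensor_left_unitality, leftUnitor_naturality]

lemma isComonHom_rightUnitor : IsComonHom (ρ_ C).hom where
  hom_counit := by simp [unitors_equal]
  hom_comul := by
    rw [Comon.tensorObj_comul, ComonObj.instTensorUnit_comul, MonoidalCategory.tensorHom_def,
      Category.assoc, Category.assoc, ← tensor_right_unitality, rightUnitor_naturality]

end TensorComon

/-! ### The unit measuring and products of measurings -/

section Symmetric

variable {V : Type w} [Category.{v} V] [MonoidalCategory V] [SymmetricCategory V]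

lemma tensorμ_tensorμ (X₁ X₂ X₃ X₄ : V) :
    tensorμ X₁ X₂ X₃ X₄ ≫ tensorμ X₁ X₃ X₂ X₄ = 𝟙 _ := by
  have : tensorμ X₁ X₃ X₂ X₄ = tensorδ X₁ X₂ X₃ X₄ := by
    rw [tensorμ, tensorδ, SymmetricCategory.braiding_swap_eq_inv_braiding X₂ X₃]
  rw [this, tensorμ_tensorδ]

variable {C C' P A B H : V} [ComonObj C] [ComonObj C'] [ComonObj P] [MonObj A] [MonObj B]

lemma IsMeasuring.unit [BimonObj H] :
    IsMeasuring ((λ_ H).hom ≫ ε[H] ≫ η[B]) where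
  one := by
    rw [leftUnitor_naturality_assoc, BimonObj.one_counit_assoc, ComonObj.instTensorUnit_counit,
      id_whiskerRight, Category.id_comp]
  mul := by
    rw [convProd_eq, tensorPairing_comp, tensorPairing, leftUnitor_naturality_assoc,
      BimonObj.mul_counit_assoc, ComonObj.instTensorUnit_comul, Category.assoc,
      Category.assoc, ← tensor_left_unitality_assoc, ← tensorHom_comp_tensorHom, Category.assoc, MonObj.one_mul_hom]
    simp

/-- On a product `hk` the value is `a(c₁, h₁) a(c₂, k₁) a'(c'₁, h₂) a'(c'₂, k₂)`. Exchanging the two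
middle factors, by commutativity of `B`, gives the convolution product of the values at `h` and `k`.
-/
lemma isMeasuring_measProd [BimonObj H] [IsCommMonObj B] {a : C ⊗ H ⟶ B} {a' : C' ⊗ H ⟶ B}
    (ha : IsMeasuring a) (ha' : IsMeasuring a') : IsMeasuring (measProd a a') where
  one := by
    have h : η[H] ≫ Δ[H] = (λ_ (𝟙_ V)).inv ≫ (η[H] ⊗ₘ η[H]) := BimonObj.one_comul H
    have h' : (C ⊗ C') ◁ (λ_ (𝟙_ V)).inv ≫
        tensorPairing (ε[C] ▷ 𝟙_ V ≫ (λ_ (𝟙_ V)).hom) (ε[C'] ▷ 𝟙_ V ≫ (λ_ (𝟙_ V)).hom) ≫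
          (λ_ (𝟙_ V)).hom =
        (ε[C] ⊗ₘ ε[C']) ▷ 𝟙_ V ≫ (λ_ (𝟙_ V)).hom ▷ 𝟙_ V ≫ (λ_ (𝟙_ V)).hom := by
      rw [← reassoc_of% whiskerRight_tensorPairing, whisker_exchange_assoc, tensorPairing,
        leftUnitor_monoidal, reassoc_of% tensorμ_tensorμ, Category.assoc]
      congr 1
      monoidal
    rw [measProd, ← whiskerLeft_comp_assoc, h, whiskerLeft_comp_assoc,
      reassoc_of% whiskerLeft_tensorPairing, ha.one, ha'.one, ← Category.assoc (ε[C] ▷ _),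
      ← Category.assoc (ε[C'] ▷ _), tensorPairing_comp, Category.assoc, MonObj.one_mul_hom, Comon.tensorObj_counit,
      comp_whiskerRight_assoc]
    simpa using h' =≫ η[B]
  mul := by
    have h1 := PairingHom.tensorμ a a a' a'
    have h2 : tensorPairing (measProd a a') (measProd a a') =
        ((C ⊗ C') ⊗ (C ⊗ C')) ◁ (Δ[H] ⊗ₘ Δ[H]) ≫
          tensorPairing (tensorPairing a a') (tensorPairing a a') ≫ (μ[B] ⊗ₘ μ[B]) := by
      rw [reassoc_of% whiskerLeft_tensorPairing, ← tensorPairing_comp, Category.assoc]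
      rfl
    have h3 : (C ⊗ C') ◁ (μ[H] ⊗ₘ μ[H]) ≫ tensorPairing a a' =
        (Δ[C] ⊗ₘ Δ[C']) ▷ ((H ⊗ H) ⊗ (H ⊗ H)) ≫
          tensorPairing (tensorPairing a a) (tensorPairing a' a') ≫ (μ[B] ⊗ₘ μ[B]) := by
      rw [whiskerLeft_tensorPairing, ha.mul, ha'.mul, convProd_eq, convProd_eq,
        reassoc_of% whiskerRight_tensorPairing, ← tensorPairing_comp, Category.assoc, Category.assoc]
    -- The interchange on `H` comes from `Δ(hk)`, the one on `C` and `C'` from the comultiplication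
    -- of `C ⊗ C'`, and the one on `B` is absorbed by commutativity.
    have h4 : ((C ⊗ C) ⊗ (C' ⊗ C')) ◁ tensorμ H H H H ≫
        tensorPairing (tensorPairing a a) (tensorPairing a' a') ≫ tensorμ B B B B =
        tensorμ C C C' C' ▷ _ ≫ tensorPairing (tensorPairing a a') (tensorPairing a a') := by
      rw [PairingHom] at h1
      rw [← h1, MonoidalCategory.tensorHom_def', Category.assoc, ← whiskerLeft_comp_assoc,
        tensorμ_tensorμ, whiskerLeft_id, Category.id_comp]
    rw [measProd, ← whiskerLeft_comp_assoc, BimonObj.mul_comul, ← measProd,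
      convProd_eq, h2, Comon.tensorObj_comul, whiskerLeft_comp_assoc, whiskerLeft_comp_assoc,
      reassoc_of% h3, ← MonObj.mul_mul_mul_comm, comp_whiskerRight_assoc]
    simp only [Category.assoc]
    rw [← whisker_exchange_assoc, ← whisker_exchange_assoc, ← reassoc_of% h4,
      ← whisker_exchange_assoc]

end Symmetric

/-! ### The universal property in transposed form -/

lemma comp_pre_eq_homUnit_iff {V : Type w} [Category.{v} V] [MonoidalCategory V] [MonoidalClosed V]
    {B H P : V} [MonObj B] [ComonObj H] (e : H ⟶ (ihom P).obj B) (u : 𝟙_ V ⟶ P) :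
    e ≫ (pre u).app B = ε[H] ≫ homUnit B ↔
      u ▷ H ≫ uncurry e = (λ_ H).hom ≫ ε[H] ≫ η[B] := by
  rw [← uncurry_injective.eq_iff, uncurry_pre_app, uncurry_natural_left, homUnit, uncurry_curry,
    leftUnitor_naturality_assoc]

section Universal

variable {V : Type w} [Category.{v} V] [MonoidalCategory V] [BraidedCategory V]
  {A B H P : V} [MonObj A] [MonObj B]

/-- Universality of a measuring, in terms of morphisms `C ⊗ A ⟶ B`. -/
structure IsUniversalMeasuring [ComonObj P] (a : P ⊗ A ⟶ B) : Prop where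
  isMeasuring : IsMeasuring a
  existsUnique : ∀ (C : V) [ComonObj C] (b : C ⊗ A ⟶ B), IsMeasuring b →
    ∃! g : C ⟶ P, IsComonHom g ∧ g ▷ A ≫ a = b

/-- This is the uniqueness half of the universal property, and the means by which identities between
comonoid morphisms into `P` are reduced to identities in `B`. -/
lemma IsUniversalMeasuring.hom_ext [ComonObj P] {a : P ⊗ A ⟶ B} (ha : IsUniversalMeasuring a)
    {C : V} [ComonObj C] (g g' : C ⟶ P) [IsComonHom g] [IsComonHom g']
    (h : g ▷ A ≫ a = g' ▷ A ≫ a) : g = g' :=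
  (ha.existsUnique C _ (ha.isMeasuring.precomp g')).unique ⟨inferInstance, h⟩
    ⟨inferInstance, rfl⟩

section Closed

variable [MonoidalClosed V]

lemma isMonHom_iff_isMeasuring {C : V} [ComonObj C] (f : A ⟶ (ihom C).obj B) :
    IsMonHom f ↔ IsMeasuring (uncurry f) := by
  have h1 : η[A] ≫ f = η[(ihom C).obj B] ↔
      C ◁ η[A] ≫ uncurry f = ε[C] ▷ 𝟙_ V ≫ (λ_ (𝟙_ V)).hom ≫ η[B] := by
    rw [← uncurry_natural_left, ← uncurry_convOne, uncurry_injective.eq_iff]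
    rfl
  have h2 : μ[A] ≫ f = (f ⊗ₘ f) ≫ μ[(ihom C).obj B] ↔
      C ◁ μ[A] ≫ uncurry f = convProd (uncurry f) (uncurry f) := by
    rw [← uncurry_natural_left, ← uncurry_convMul, uncurry_injective.eq_iff]
    rfl
  exact ⟨fun h => ⟨h1.1 h.one_hom, h2.1 h.mul_hom⟩, fun h => ⟨h1.2 h.one, h2.2 h.mul⟩⟩

lemma isUniversal_iff [ComonObj P] (e : A ⟶ (ihom P).obj B) :
    IsUniversal A B P e ↔ IsUniversalMeasuring (uncurry e) := by
  have h (C : V) (g : C ⟶ P) (f : A ⟶ (ihom C).obj B) :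
      e ≫ (pre g).app B = f ↔ g ▷ A ≫ uncurry e = uncurry f := by
    rw [← uncurry_pre_app, uncurry_injective.eq_iff]
  constructor
  · refine fun he => ⟨(isMonHom_iff_isMeasuring e).1 he.isMonHom, fun C _ b hb => ?_⟩
    have := he.existsUnique C (curry b) ((isMonHom_iff_isMeasuring _).2 (by rwa [uncurry_curry]))
    simpa only [h, uncurry_curry] using this
  · refine fun he => ⟨(isMonHom_iff_isMeasuring e).2 he.isMeasuring, fun C _ f hf => ?_⟩
    simpa only [h] using he.existsUnique C _ ((isMonHom_iff_isMeasuring f).1 hf)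

lemma comp_pre_eq_homTensor_iff [ComonObj H] (e : H ⟶ (ihom P).obj B) (m : P ⊗ P ⟶ P) :
    e ≫ (pre m).app B = Δ[H] ≫ (e ⊗ₘ e) ≫ homTensor P P B ↔
      m ▷ H ≫ uncurry e = measProd (uncurry e) (uncurry e) := by
  rw [← uncurry_injective.eq_iff, uncurry_pre_app, uncurry_natural_left, uncurry_natural_left,
    homTensor, uncurry_curry, measProd, tensorPairing, tensorμ_natural_right_assoc,
    tensorHom_comp_tensorHom_assoc, Category.assoc, ← uncurry_eq]

end Closed

end Universal

/-! ### The induced bimonoid structure: existence and uniqueness -/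

section Symmetric

variable {V : Type w} [Category.{v} V] [MonoidalCategory V] [SymmetricCategory V]
  {B H P : V} [BimonObj H] [MonObj B]

lemma isInducedBimonoid_iff [MonoidalClosed V] [cP : ComonObj P] (e : H ⟶ (ihom P).obj B)
    (b : BimonObj P) :
    IsInducedBimonoid H B P e b ↔ b.toComonObj = cP ∧
      b.one ▷ H ≫ uncurry e = (λ_ H).hom ≫ ε[H] ≫ η[B] ∧
      b.mul ▷ H ≫ uncurry e = measProd (uncurry e) (uncurry e) := by
  rw [← comp_pre_eq_homUnit_iff, ← comp_pre_eq_homTensor_iff]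
  exact ⟨fun h => ⟨h.1, h.2, h.3⟩, fun h => ⟨h.1, h.2.1, h.2.2⟩⟩

/-- Unit and multiplication are the morphisms classified by `IsMeasuring.unit` and
`isMeasuring_measProd`. Compatibility with the comonoid structure says exactly that they are
comonoid morphisms; the monoid laws follow by `hom_ext` from those of `measProd`. -/
lemma IsUniversalMeasuring.exists_bimonObj [IsCommMonObj B] [cP : ComonObj P] {a : P ⊗ H ⟶ B}
    (ha : IsUniversalMeasuring a) :
    ∃ b : BimonObj P, b.toComonObj = cP ∧ b.one ▷ H ≫ a = (λ_ H).hom ≫ ε[H] ≫ η[B] ∧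
      b.mul ▷ H ≫ a = measProd a a := by
  obtain ⟨u, ⟨hu, hua⟩, -⟩ := ha.existsUnique (𝟙_ V) _ (IsMeasuring.unit (H := H) (B := B))
  obtain ⟨m, ⟨hm, hma⟩, -⟩ := ha.existsUnique (P ⊗ P) _ (isMeasuring_measProd ha.isMeasuring ha.isMeasuring)
  refine ⟨
    { toComonObj := cP
      one := u
      mul := m
      one_mul := ?_
      mul_one := ?_
      mul_assoc := ?_
      mul_comul := ?_
      one_comul := ?_
      mul_counit := hm.hom_counit
      one_counit := hu.hom_counit }, rfl, hua, hma⟩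
  · have := isComonHom_whiskerRight (E := P) u
    have := isComonHom_leftUnitor (C := P)
    refine ha.hom_ext _ _ ?_
    rw [comp_whiskerRight_assoc, hma, ← tensorHom_id u P, whiskerRight_measProd, hua, id_whiskerRight,
      Category.id_comp, one_measProd]
  · have := isComonHom_whiskerLeft (E := P) u
    have := isComonHom_rightUnitor (C := P)
    refine ha.hom_ext _ _ ?_
    rw [comp_whiskerRight_assoc, hma, ← id_tensorHom, whiskerRight_measProd, hua, id_whiskerRight,
      Category.id_comp, measProd_one]
  · have := isComonHom_whiskerRight (E := P) m
    have := isComonHom_whiskerLeft (E := P) m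
    have := isComonHom_associator (C := P) (D := P) (E := P)
    refine ha.hom_ext _ _ ?_
    rw [comp_whiskerRight_assoc, comp_whiskerRight_assoc, comp_whiskerRight_assoc, hma,
      ← tensorHom_id m P, ← id_tensorHom, whiskerRight_measProd, whiskerRight_measProd, hma,
      id_whiskerRight, Category.id_comp, measProd_assoc]
  · simp
  · exact hu.hom_comul

lemma isComonHom_bimonObj_one {P : V} [cP : ComonObj P] (b : BimonObj P) (h : b.toComonObj = cP) :
    IsComonHom b.one := by
  subst h
  exact ⟨b.one_counit, b.one_comul⟩

lemma isComonHom_bimonObj_mul {P : V} [cP : ComonObj P] (b : BimonObj P) (h : b.toComonObj = cP) :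
    IsComonHom b.mul := by
  subst h
  exact ⟨b.mul_counit, by simpa only [Comon.tensorObj_comul, Category.assoc] using b.mul_comul⟩

lemma IsUniversalMeasuring.bimonObj_one_eq [cP : ComonObj P] {a : P ⊗ H ⟶ B}
    (ha : IsUniversalMeasuring a) (b b' : BimonObj P) (hb : b.toComonObj = cP)
    (hb' : b'.toComonObj = cP) (h : b.one ▷ H ≫ a = b'.one ▷ H ≫ a) : b.one = b'.one := by
  have := isComonHom_bimonObj_one b hb
  have := isComonHom_bimonObj_one b' hb'
  exact ha.hom_ext _ _ h

lemma IsUniversalMeasuring.bimonObj_mul_eq [cP : ComonObj P] {a : P ⊗ H ⟶ B}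
    (ha : IsUniversalMeasuring a) (b b' : BimonObj P) (hb : b.toComonObj = cP)
    (hb' : b'.toComonObj = cP) (h : b.mul ▷ H ≫ a = b'.mul ▷ H ≫ a) : b.mul = b'.mul := by
  have := isComonHom_bimonObj_mul b hb
  have := isComonHom_bimonObj_mul b' hb'
  exact ha.hom_ext _ _ h

lemma IsUniversalMeasuring.bimonObj_ext [cP : ComonObj P] {a : P ⊗ H ⟶ B}
    (ha : IsUniversalMeasuring a) (b b' : BimonObj P) (hb : b.toComonObj = cP)
    (hb' : b'.toComonObj = cP) (hone : b.one ▷ H ≫ a = b'.one ▷ H ≫ a)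
    (hmul : b.mul ▷ H ≫ a = b'.mul ▷ H ≫ a) : b = b' := by
  have h1 := ha.bimonObj_one_eq b b' hb hb' hone
  have h2 := ha.bimonObj_mul_eq b b' hb hb' hmul
  obtain ⟨⟩ := b
  obtain ⟨⟩ := b'
  subst hb
  subst hb'
  congr 1
  -- A monoid structure is determined by its multiplication.
  exact MonObj.ext _ _ h2

end Symmetric

/-! ### Measurings on colimits of comonoids -/

section Descent

variable {V : Type w} [Category.{v} V] [MonoidalCategory V] [BraidedCategory V] [MonoidalClosed V]

/-- The transpose `C ⟶ [A, B]` of `C ⊗ A ⟶ B`. -/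
def flipCurry {C A B : V} (a : C ⊗ A ⟶ B) : C ⟶ (ihom A).obj B :=
  curry ((β_ A C).hom ≫ a)

lemma comp_flipCurry {C D A B : V} (f : D ⟶ C) (a : C ⊗ A ⟶ B) :
    f ≫ flipCurry a = flipCurry (f ▷ A ≫ a) := by
  rw [flipCurry, flipCurry, ← curry_natural_left, BraidedCategory.braiding_naturality_right_assoc]

lemma flipCurry_injective {C A B : V} :
    Function.Injective (flipCurry : (C ⊗ A ⟶ B) → (C ⟶ (ihom A).obj B)) := fun a b h => by
  simpa [flipCurry, curry_injective.eq_iff] using h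

lemma flipCurry_surjective {C A B : V} :
    Function.Surjective (flipCurry : (C ⊗ A ⟶ B) → (C ⟶ (ihom A).obj B)) := fun f =>
  ⟨(β_ A C).inv ≫ uncurry f, by simp [flipCurry]⟩

/-- A comonoid structure and a measuring are induced on an object `Q` by a jointly epimorphic family
of morphisms from comonoids with measurings, if the structure morphisms extend to `Q`. -/
lemma exists_comonObj_of_jointly_epi {J : Type*} {C : J → V} [∀ i, ComonObj (C i)] {A B Q : V}
    [MonObj A] [MonObj B] (π : ∀ i, C i ⟶ Q)
    (hπ : ∀ {X : V} (f g : Q ⟶ X), (∀ i, π i ≫ f = π i ≫ g) → f = g)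
    (a : ∀ i, C i ⊗ A ⟶ B) (ha : ∀ i, IsMeasuring (a i))
    (hδ : ∃ δ : Q ⟶ Q ⊗ Q, ∀ i, π i ≫ δ = Δ[C i] ≫ (π i ⊗ₘ π i))
    (hε : ∃ ε' : Q ⟶ 𝟙_ V, ∀ i, π i ≫ ε' = ε[C i])
    (hq : ∃ q : Q ⟶ (ihom A).obj B, ∀ i, π i ≫ q = flipCurry (a i)) :
    ∃ (_ : ComonObj Q) (q : Q ⊗ A ⟶ B), (∀ i, IsComonHom (π i)) ∧ IsMeasuring q ∧
      ∀ i, π i ▷ A ≫ q = a i := by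
  obtain ⟨δ, hδ⟩ := hδ
  obtain ⟨ε', hε⟩ := hε
  obtain ⟨q, hq⟩ := hq
  obtain ⟨q, rfl⟩ := flipCurry_surjective q
  have hq' (i) : π i ▷ A ≫ q = a i := flipCurry_injective (by rw [← comp_flipCurry, hq])
  -- The family stays jointly epimorphic after tensoring, since morphisms out of `Q ⊗ X` transpose
  -- to morphisms out of `Q`.
  have hπ' {X Y : V} (f g : Q ⊗ X ⟶ Y) (h : ∀ i, π i ▷ X ≫ f = π i ▷ X ≫ g) : f = g :=
    flipCurry_injective <| hπ _ _ fun i => by rw [comp_flipCurry, comp_flipCurry, h]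
  let cQ : ComonObj Q :=
    { counit := ε'
      comul := δ
      counit_comul := hπ _ _ fun i => by
        rw [reassoc_of% hδ, MonoidalCategory.tensorHom_def', Category.assoc, ← comp_whiskerRight,
          hε, whisker_exchange, ComonObj.counit_comul_assoc, leftUnitor_inv_naturality]
      comul_counit := hπ _ _ fun i => by
        rw [reassoc_of% hδ, MonoidalCategory.tensorHom_def, Category.assoc, ← whiskerLeft_comp,
          hε, ← whisker_exchange, ComonObj.comul_counit_assoc, rightUnitor_inv_naturality]
      comul_assoc := hπ _ _ fun i => by
        rw [reassoc_of% hδ, reassoc_of% hδ, ← tensorHom_id, ← id_tensorHom,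
          tensorHom_comp_tensorHom, tensorHom_comp_tensorHom_assoc, hδ, Category.comp_id,
          ← Category.id_comp (π i), ← tensorHom_comp_tensorHom, ← tensorHom_comp_tensorHom_assoc,
          Category.id_comp, id_tensorHom, tensorHom_id, associator_naturality,
          ComonObj.comul_assoc_assoc] }
  have hC (i) : IsComonHom (π i) := ⟨hε i, hδ i⟩
  refine ⟨cQ, q, hC, ⟨hπ' _ _ fun i => ?_, hπ' _ _ fun i => ?_⟩, hq'⟩
  · rw [← whisker_exchange_assoc, hq', (ha i).one, ← comp_whiskerRight_assoc,
      IsComonHom.hom_counit]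
  · rw [← whisker_exchange_assoc, hq', (ha i).mul, whiskerRight_convProd, hq']

/-- The quotient identifying two morphisms into a comonoid with a measuring inherits the structure
if the structure morphisms coequalize them. -/
lemma exists_comonObj_coequalizer {A B P X : V} [MonObj A] [MonObj B] [ComonObj P] {a : P ⊗ A ⟶ B}
    (ha : IsMeasuring a) (f g : X ⟶ P) [Limits.HasCoequalizer f g]
    (hδ : ∀ {Q : V} (π : P ⟶ Q), f ≫ π = g ≫ π →
      f ≫ Δ[P] ≫ (π ⊗ₘ π) = g ≫ Δ[P] ≫ (π ⊗ₘ π))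
    (hε : f ≫ ε[P] = g ≫ ε[P]) (hq : f ▷ A ≫ a = g ▷ A ≫ a) :
    ∃ (_ : ComonObj (Limits.coequalizer f g)) (q : Limits.coequalizer f g ⊗ A ⟶ B),
      IsComonHom (Limits.coequalizer.π f g) ∧ IsMeasuring q ∧
        Limits.coequalizer.π f g ▷ A ≫ q = a := by
  obtain ⟨c, q, hπ, hq, hqa⟩ := exists_comonObj_of_jointly_epi (J := Unit) (C := fun _ => P)
    (Q := Limits.coequalizer f g) (fun _ => Limits.coequalizer.π f g)
    (fun f' g' h => (cancel_epi (Limits.coequalizer.π f g)).1 (h ())) (fun _ => a) (fun _ => ha)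
    ⟨Limits.coequalizer.desc _ (hδ _ (Limits.coequalizer.condition f g)),
      fun _ => Limits.coequalizer.π_desc _ _⟩
    ⟨Limits.coequalizer.desc _ hε, fun _ => Limits.coequalizer.π_desc _ _⟩
    ⟨Limits.coequalizer.desc (flipCurry a) (by rw [comp_flipCurry, comp_flipCurry, hq]),
      fun _ => Limits.coequalizer.π_desc _ _⟩
  exact ⟨c, q, hπ (), hq, hqa ()⟩

/-- Two morphisms into a universal measuring comonoid are equal if the quotient identifying them
inherits its structure. -/
lemma IsUniversalMeasuring.eq_of_coequalizer [Limits.HasCoequalizers V] {A B P X : V} [MonObj A]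
    [MonObj B] [ComonObj P] {a : P ⊗ A ⟶ B} (ha : IsUniversalMeasuring a) {f g : X ⟶ P}
    (hδ : ∀ {Q : V} (π : P ⟶ Q), f ≫ π = g ≫ π →
      f ≫ Δ[P] ≫ (π ⊗ₘ π) = g ≫ Δ[P] ≫ (π ⊗ₘ π))
    (hε : f ≫ ε[P] = g ≫ ε[P]) (hq : f ▷ A ≫ a = g ▷ A ≫ a) : f = g := by
  obtain ⟨_, q, hπ, hq, hqa⟩ := exists_comonObj_coequalizer ha.isMeasuring f g hδ hε hq
  obtain ⟨r, ⟨hr, hra⟩, -⟩ := ha.existsUnique _ q hq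
  -- The composite is an endomorphism of `P` over the measuring, hence the identity. So the
  -- coequalizer projection is split mono, and it equalizes `f` and `g`.
  have h : Limits.coequalizer.π f g ≫ r = 𝟙 P := ha.hom_ext _ _ (by
    rw [comp_whiskerRight_assoc, hra, hqa, id_whiskerRight, Category.id_comp])
  rw [← Category.comp_id f, ← Category.comp_id g, ← h, Limits.coequalizer.condition_assoc]

end Descent

/-! ### Antipodes -/

section Antipode

variable {V : Type w} [Category.{v} V] [MonoidalCategory V] [SymmetricCategory V]

lemma braiding_comp_tensorμ (X₁ X₂ Y₁ Y₂ : V) :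
    (β_ (X₁ ⊗ X₂) (Y₁ ⊗ Y₂)).hom ≫ tensorμ Y₁ Y₂ X₁ X₂ =
      tensorμ X₁ X₂ Y₁ Y₂ ≫ ((β_ X₁ Y₁).hom ⊗ₘ (β_ X₂ Y₂).hom) := by
  have h := congrArg (· ≫ tensorμ Y₁ Y₂ X₁ X₂) (tensorμ_braiding X₁ Y₁ X₂ Y₂)
  simp only [Category.assoc, tensorμ_tensorμ, Category.comp_id] at h
  rw [← h, reassoc_of% tensorμ_tensorμ]

lemma isComonHom_braiding (C D : V) [ComonObj C] [ComonObj D] : IsComonHom (β_ C D).hom where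
  hom_counit := by
    rw [Comon.tensorObj_counit, Comon.tensorObj_counit,
      ← BraidedCategory.braiding_naturality_assoc, braiding_leftUnitor, unitors_equal]
  hom_comul := by
    rw [Comon.tensorObj_comul, Comon.tensorObj_comul, ← BraidedCategory.braiding_naturality_assoc,
      braiding_comp_tensorμ, Category.assoc]

/-- The comonoid with the opposite comultiplication. -/
@[reducible] def copComonObj (C : V) [ComonObj C] : ComonObj C where
  counit := ε[C]
  comul := Δ[C] ≫ (β_ C C).hom
  counit_comul := by
    rw [Category.assoc, ← BraidedCategory.braiding_naturality_right,
      ComonObj.comul_counit_assoc, ← cancel_mono (λ_ C).hom, Category.assoc, braiding_leftUnitor,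
      Iso.inv_hom_id, Iso.inv_hom_id]
  comul_counit := by
    rw [Category.assoc, ← BraidedCategory.braiding_naturality_left,
      ComonObj.counit_comul_assoc, ← cancel_mono (ρ_ C).hom, Category.assoc, braiding_rightUnitor,
      Iso.inv_hom_id, Iso.inv_hom_id]
  comul_assoc := by
    have h : C ◁ (β_ C C).hom ≫ (β_ C (C ⊗ C)).hom ≫ (α_ C C C).hom =
        (α_ C C C).inv ≫ (β_ C C).hom ▷ C ≫ (β_ (C ⊗ C) C).hom := by
      simpa using (BraidedCategory.yang_baxter C C C).symm
    rw [Category.assoc, Category.assoc, ← BraidedCategory.braiding_naturality_right_assoc,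
      ← BraidedCategory.braiding_naturality_left, whiskerLeft_comp_assoc, comp_whiskerRight_assoc,
      h, ComonObj.comul_assoc_flip_assoc]

/-- The bimonoid with the opposite comultiplication. -/
@[reducible] def copBimonObj (H : V) [BimonObj H] : BimonObj H where
  toComonObj := copComonObj H
  mul_comul := by
    change μ[H] ≫ Δ[H] ≫ (β_ H H).hom = (Δ[H] ≫ (β_ H H).hom ⊗ₘ Δ[H] ≫ (β_ H H).hom) ≫
      tensorμ H H H H ≫ (μ[H] ⊗ₘ μ[H])
    rw [BimonObj.mul_comul_assoc, ← tensorHom_comp_tensorHom, Category.assoc,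
      ← reassoc_of% tensorμ_braiding, BraidedCategory.braiding_naturality]
  one_comul := by
    change η[H] ≫ Δ[H] ≫ (β_ H H).hom = _
    rw [BimonObj.one_comul_assoc, MonObj.one_braiding]
  mul_counit := BimonObj.mul_counit H
  one_counit := BimonObj.one_counit H

end Antipode

/-- Coassociativity brings the fourfold comultiplication into the form `p₁ ⊗ ((p₂ ⊗ p₃) ⊗ p₄)`,
where the inner pair is itself a comultiplication. -/
lemma comul_tensorHom_comul {V : Type w} [Category.{v} V] [MonoidalCategory V] {P : V}
    [ComonObj P] :
    Δ[P] ≫ (Δ[P] ⊗ₘ Δ[P]) ≫ (α_ P P (P ⊗ P)).hom ≫ P ◁ (α_ P P P).inv =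
      Δ[P] ≫ P ◁ (Δ[P] ≫ Δ[P] ▷ P) := by
  rw [MonoidalCategory.tensorHom_def, Category.assoc, associator_naturality_right_assoc,
    ← ComonObj.comul_assoc_assoc, ← whiskerLeft_comp, ← whiskerLeft_comp, ComonObj.comul_assoc_assoc,
    Iso.hom_inv_id, Category.comp_id]

/-! ### Collapsing nested pairs in a fourfold comultiplication -/

section Collapse

variable {V : Type w} [Category.{v} V] [MonoidalCategory V] [SymmetricCategory V]

/-- By the hexagon, `X₁` passes `X₂ ⊗ X₃` as one block, so a morphism on that block can slide
through the braiding. -/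
lemma braiding_whiskerRight_tensorμ (X₁ X₂ X₃ X₄ : V) :
    (β_ X₁ X₂).hom ▷ (X₃ ⊗ X₄) ≫ tensorμ X₂ X₁ X₃ X₄ =
      (α_ X₁ X₂ (X₃ ⊗ X₄)).hom ≫ X₁ ◁ (α_ X₂ X₃ X₄).inv ≫ (α_ X₁ (X₂ ⊗ X₃) X₄).inv ≫
        (β_ X₁ (X₂ ⊗ X₃)).hom ▷ X₄ ≫ (α_ (X₂ ⊗ X₃) X₁ X₄).hom := by
  rw [tensorμ, BraidedCategory.braiding_tensor_right_hom]
  monoidal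

lemma braiding_whiskerLeft_tensorμ (X₁ X₂ X₃ X₄ : V) :
    (X₁ ⊗ X₂) ◁ (β_ X₃ X₄).hom ≫ tensorμ X₁ X₂ X₄ X₃ =
      (α_ X₁ X₂ (X₃ ⊗ X₄)).hom ≫ X₁ ◁ (α_ X₂ X₃ X₄).inv ≫ X₁ ◁ (β_ (X₂ ⊗ X₃) X₄).hom ≫
        (α_ X₁ X₄ (X₂ ⊗ X₃)).inv := by
  rw [tensorμ, BraidedCategory.braiding_tensor_left_hom]
  monoidal

variable {P Q : V} [ComonObj P]

/-- If `w (p₁ ⊗ p₂) = ε (p) j`, then `w (p₂ ⊗ p₃) ⊗ w (p₁ ⊗ p₄) = ε (p) (j ⊗ j)`. -/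
lemma comul_braiding_left_collapse {w : P ⊗ P ⟶ Q} {j : 𝟙_ V ⟶ Q} (h : Δ[P] ≫ w = ε[P] ≫ j) :
    Δ[P] ≫ (Δ[P] ⊗ₘ Δ[P]) ≫ (β_ P P).hom ▷ (P ⊗ P) ≫ tensorμ P P P P ≫ (w ⊗ₘ w) =
      ε[P] ≫ (λ_ (𝟙_ V)).inv ≫ (j ⊗ₘ j) := by
  have h1 : P ◁ (w ▷ P) ≫ (α_ P Q P).inv ≫ (β_ P Q).hom ▷ P ≫ (α_ Q P P).hom ≫ Q ◁ w =
      (α_ P (P ⊗ P) P).inv ≫ (β_ P (P ⊗ P)).hom ▷ P ≫ (α_ (P ⊗ P) P P).hom ≫ (w ⊗ₘ w) := by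
    rw [associator_inv_naturality_middle_assoc, ← comp_whiskerRight_assoc,
      BraidedCategory.braiding_naturality_right, comp_whiskerRight_assoc,
      associator_naturality_left_assoc, MonoidalCategory.tensorHom_def]
  -- Once the inner pair has become `j` and a counit, the counit law turns the outer pair into
  -- `Δ(p)`, and `h` applies a second time.
  have h2 : P ◁ (j ▷ P) ≫ (α_ P Q P).inv ≫ (β_ P Q).hom ▷ P ≫ (α_ Q P P).hom ≫ Q ◁ w =
      P ◁ (λ_ P).hom ≫ w ≫ (λ_ Q).inv ≫ j ▷ Q := by
    rw [associator_inv_naturality_middle_assoc, ← comp_whiskerRight_assoc,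
      BraidedCategory.braiding_naturality_right, comp_whiskerRight_assoc,
      associator_naturality_left_assoc, ← whisker_exchange, leftUnitor_inv_naturality_assoc]
    simp
  rw [reassoc_of% braiding_whiskerRight_tensorμ, reassoc_of% comul_tensorHom_comul, ← h1,
    ← whiskerLeft_comp_assoc, Category.assoc, ← comp_whiskerRight, h, comp_whiskerRight,
    ComonObj.counit_comul_assoc, whiskerLeft_comp_assoc, h2, ← whiskerLeft_comp_assoc,
    Iso.inv_hom_id, whiskerLeft_id, Category.id_comp, reassoc_of% h, leftUnitor_inv_naturality_assoc,
    MonoidalCategory.tensorHom_def']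

/-- If `w (p₁ ⊗ p₂) = ε (p) j`, then `w (p₁ ⊗ p₄) ⊗ w (p₂ ⊗ p₃) = ε (p) (j ⊗ j)`. -/
lemma comul_braiding_right_collapse {w : P ⊗ P ⟶ Q} {j : 𝟙_ V ⟶ Q} (h : Δ[P] ≫ w = ε[P] ≫ j) :
    Δ[P] ≫ (Δ[P] ⊗ₘ Δ[P]) ≫ (P ⊗ P) ◁ (β_ P P).hom ≫ tensorμ P P P P ≫ (w ⊗ₘ w) =
      ε[P] ≫ (λ_ (𝟙_ V)).inv ≫ (j ⊗ₘ j) := by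
  have h1 : P ◁ (w ▷ P) ≫ P ◁ (β_ Q P).hom ≫ (α_ P P Q).inv ≫ w ▷ Q =
      P ◁ (β_ (P ⊗ P) P).hom ≫ (α_ P P (P ⊗ P)).inv ≫ (w ⊗ₘ w) := by
    rw [← whiskerLeft_comp_assoc, BraidedCategory.braiding_naturality_left, whiskerLeft_comp_assoc,
      associator_inv_naturality_right_assoc, MonoidalCategory.tensorHom_def']
  have h2 : P ◁ (j ▷ P) ≫ P ◁ (β_ Q P).hom ≫ (α_ P P Q).inv ≫ w ▷ Q =
      P ◁ (λ_ P).hom ≫ w ≫ (ρ_ Q).inv ≫ Q ◁ j := by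
    rw [← whiskerLeft_comp_assoc, BraidedCategory.braiding_naturality_left, whiskerLeft_comp_assoc,
      associator_inv_naturality_right_assoc, whisker_exchange, rightUnitor_inv_naturality_assoc]
    simp
  rw [reassoc_of% braiding_whiskerLeft_tensorμ, reassoc_of% comul_tensorHom_comul, ← h1,
    ← whiskerLeft_comp_assoc, Category.assoc, ← comp_whiskerRight, h, comp_whiskerRight,
    ComonObj.counit_comul_assoc, whiskerLeft_comp_assoc, h2, ← whiskerLeft_comp_assoc,
    Iso.inv_hom_id, whiskerLeft_id, Category.id_comp, reassoc_of% h,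
    rightUnitor_inv_naturality_assoc, MonoidalCategory.tensorHom_def, unitors_inv_equal]

end Collapse

/-! ### The Hopf case -/

section Hopf

variable {V : Type w} [Category.{v} V] [MonoidalCategory V] [SymmetricCategory V]
  {B H P : V} [MonObj B]

/-- Swapping both pairs of arguments swaps the two values in `B`, which commutativity undoes; hence
swapping either pair has the same effect. -/
lemma whiskerLeft_braiding_tensorPairing [IsCommMonObj B] (a : P ⊗ H ⟶ B) :
    (P ⊗ P) ◁ (β_ H H).hom ≫ tensorPairing a a ≫ μ[B] =
      (β_ P P).hom ▷ (H ⊗ H) ≫ tensorPairing a a ≫ μ[B] := by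
  have h := PairingHom.braiding a a
  rw [PairingHom] at h
  rw [← cancel_epi ((β_ P P).hom ▷ (H ⊗ H)), ← comp_whiskerRight_assoc,
    SymmetricCategory.symmetry, id_whiskerRight, Category.id_comp,
    ← MonoidalCategory.tensorHom_def_assoc, reassoc_of% h, IsCommMonObj.mul_comm]

/-- Precomposing a measuring with a morphism that reverses multiplication gives a measuring for
the opposite comultiplication. -/
lemma IsMeasuring.cop [IsCommMonObj B] [MonObj H] [ComonObj P] {a : P ⊗ H ⟶ B}
    (ha : IsMeasuring a) {s : H ⟶ H} (hs_one : η[H] ≫ s = η[H])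
    (hs_mul : μ[H] ≫ s = (s ⊗ₘ s) ≫ (β_ H H).hom ≫ μ[H]) :
    letI := copComonObj P
    IsMeasuring (P ◁ s ≫ a) := by
  have h1 : P ◁ (η[H] ≫ s) ≫ a = ε[P] ▷ 𝟙_ V ≫ (λ_ (𝟙_ V)).hom ≫ η[B] := by
    rw [hs_one, ha.one]
  have h2 : P ◁ (μ[H] ≫ s) ≫ a =
      (Δ[P] ≫ (β_ P P).hom) ▷ (H ⊗ H) ≫ tensorPairing (P ◁ s ≫ a) (P ◁ s ≫ a) ≫ μ[B] := by
    rw [hs_mul, whiskerLeft_comp_assoc, whiskerLeft_comp_assoc, ha.mul,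
      convProd_eq, whisker_exchange_assoc, whiskerLeft_braiding_tensorPairing, ← comp_whiskerRight_assoc,
      whisker_exchange_assoc, reassoc_of% whiskerLeft_tensorPairing]
  refine @IsMeasuring.mk _ _ _ _ _ _ _ (copComonObj P) _ _ _ ?_ ?_
  · rwa [← whiskerLeft_comp_assoc]
  · rw [← whiskerLeft_comp_assoc, h2]
    exact (@convProd_eq _ _ _ _ _ _ _ _ (copComonObj P) _ _ _).symm

variable [BimonObj H] [BimonObj P] {a : P ⊗ H ⟶ B}

/-- Adjointness along `a` respects convolution: `a(f(p₁) g(p₂), h) = a(p₁, s(h₁)) a(p₂, t(h₂)) =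
a(p, s(h₁) t(h₂))`. -/
lemma IsMeasuring.conv_whiskerRight (ha : IsMeasuring a)
    (hmul : μ[P] ▷ H ≫ a = measProd a a) {f g : P ⟶ P} {s t : H ⟶ H}
    (hf : f ▷ H ≫ a = P ◁ s ≫ a) (hg : g ▷ H ≫ a = P ◁ t ≫ a) :
    (Δ[P] ≫ (f ⊗ₘ g) ≫ μ[P]) ▷ H ≫ a = P ◁ (Δ[H] ≫ (s ⊗ₘ t) ≫ μ[H]) ≫ a := by
  rw [comp_whiskerRight_assoc, comp_whiskerRight_assoc, hmul, whiskerRight_measProd, hf, hg,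
    measProd, ← whisker_exchange_assoc, whiskerLeft_comp_assoc, whiskerLeft_comp_assoc, ha.mul,
    whiskerLeft_convProd, convProd_eq]

lemma IsMeasuring.counit_comp_unit_whiskerRight (ha : IsMeasuring a)
    (hone : η[P] ▷ H ≫ a = (λ_ H).hom ≫ ε[H] ≫ η[B]) :
    (ε[P] ≫ η[P]) ▷ H ≫ a = P ◁ (ε[H] ≫ η[H]) ≫ a := by
  rw [comp_whiskerRight_assoc, hone, whiskerLeft_comp_assoc, ha.one, whisker_exchange_assoc,
    leftUnitor_naturality_assoc]

variable [MonoidalClosed V] [Limits.HasCoequalizers V]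

/-- Since `f` reverses comultiplication, `Δ(f(p₁) p₂) = f(p₂) p₃ ⊗ f(p₁) p₄`. In a quotient where
`f(p₁) p₂` becomes `ε(p) 1`, the inner factor collapses and then the outer one, so the
comultiplication descends to it. -/
lemma IsUniversalMeasuring.comul_antipode_left (ha : IsUniversalMeasuring a)
    (hone : η[P] ▷ H ≫ a = (λ_ H).hom ≫ ε[H] ≫ η[B]) (hmul : μ[P] ▷ H ≫ a = measProd a a)
    {f : P ⟶ P} (hf_counit : f ≫ ε[P] = ε[P])
    (hf_comul : f ≫ Δ[P] = Δ[P] ≫ (β_ P P).hom ≫ (f ⊗ₘ f)) {s : H ⟶ H}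
    (hs : Δ[H] ≫ s ▷ H ≫ μ[H] = ε[H] ≫ η[H]) (hf : f ▷ H ≫ a = P ◁ s ≫ a) :
    Δ[P] ≫ f ▷ P ≫ μ[P] = ε[P] ≫ η[P] := by
  refine ha.eq_of_coequalizer (fun {Q} π hπ => ?_) ?_ ?_
  · rw [Category.assoc, Category.assoc, Category.assoc] at hπ
    have h : f ▷ P ≫ (Δ[P] ⊗ₘ Δ[P]) = (Δ[P] ⊗ₘ Δ[P]) ≫ (β_ P P).hom ▷ (P ⊗ P) ≫
        ((f ⊗ₘ f) ⊗ₘ (𝟙 P ⊗ₘ 𝟙 P)) := by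
      rw [← tensorHom_id, ← tensorHom_id, tensorHom_comp_tensorHom, tensorHom_comp_tensorHom,
        tensorHom_comp_tensorHom, hf_comul]
      simp
    have := comul_braiding_left_collapse (w := f ▷ P ≫ μ[P] ≫ π) (j := η[P] ≫ π) hπ
    simp only [Category.assoc, BimonObj.mul_comul_assoc, BimonObj.one_comul_assoc]
    rw [reassoc_of% h, tensorμ_natural_assoc, tensorHom_comp_tensorHom, tensorHom_comp_tensorHom,
      tensorHom_id, this]
    simp [MonObj.tensorObj.one_def]
  · rw [Category.assoc, Category.assoc, Category.assoc, BimonObj.mul_counit, BimonObj.one_counit,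
      Comon.tensorObj_counit, ← tensorHom_id, tensorHom_comp_tensorHom_assoc, hf_counit,
      Category.id_comp, reassoc_of% (ComonObj.counit_comul_hom ε[P])]
    simp
  -- Paired with `H`, the identity is the antipode axiom of `H`.
  · rw [ha.isMeasuring.counit_comp_unit_whiskerRight hone, ← hs, ← tensorHom_id f, ← tensorHom_id s,
      ha.isMeasuring.conv_whiskerRight hmul hf (g := 𝟙 P) (t := 𝟙 H) (by simp)]

lemma IsUniversalMeasuring.comul_antipode_right (ha : IsUniversalMeasuring a)
    (hone : η[P] ▷ H ≫ a = (λ_ H).hom ≫ ε[H] ≫ η[B]) (hmul : μ[P] ▷ H ≫ a = measProd a a)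
    {f : P ⟶ P} (hf_counit : f ≫ ε[P] = ε[P])
    (hf_comul : f ≫ Δ[P] = Δ[P] ≫ (β_ P P).hom ≫ (f ⊗ₘ f)) {s : H ⟶ H}
    (hs : Δ[H] ≫ H ◁ s ≫ μ[H] = ε[H] ≫ η[H]) (hf : f ▷ H ≫ a = P ◁ s ≫ a) :
    Δ[P] ≫ P ◁ f ≫ μ[P] = ε[P] ≫ η[P] := by
  refine ha.eq_of_coequalizer (fun {Q} π hπ => ?_) ?_ ?_
  · rw [Category.assoc, Category.assoc, Category.assoc] at hπ
    have h : P ◁ f ≫ (Δ[P] ⊗ₘ Δ[P]) = (Δ[P] ⊗ₘ Δ[P]) ≫ (P ⊗ P) ◁ (β_ P P).hom ≫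
        ((𝟙 P ⊗ₘ 𝟙 P) ⊗ₘ (f ⊗ₘ f)) := by
      rw [← id_tensorHom, ← id_tensorHom, tensorHom_comp_tensorHom, tensorHom_comp_tensorHom,
        tensorHom_comp_tensorHom, hf_comul]
      simp
    have := comul_braiding_right_collapse (w := P ◁ f ≫ μ[P] ≫ π) (j := η[P] ≫ π) hπ
    simp only [Category.assoc, BimonObj.mul_comul_assoc, BimonObj.one_comul_assoc]
    rw [reassoc_of% h, tensorμ_natural_assoc, tensorHom_comp_tensorHom, tensorHom_comp_tensorHom,
      id_tensorHom, this]
    simp [MonObj.tensorObj.one_def]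
  · rw [Category.assoc, Category.assoc, Category.assoc, BimonObj.mul_counit, BimonObj.one_counit,
      Comon.tensorObj_counit, ← id_tensorHom, tensorHom_comp_tensorHom_assoc, hf_counit,
      Category.id_comp, reassoc_of% (ComonObj.counit_comul_hom ε[P])]
    simp
  · rw [ha.isMeasuring.counit_comp_unit_whiskerRight hone, ← hs, ← id_tensorHom P f, ← id_tensorHom H s,
      ha.isMeasuring.conv_whiskerRight hmul (f := 𝟙 P) (s := 𝟙 H) (by simp) hf]

lemma IsUniversalMeasuring.isHopf [IsCommMonObj B] (ha : IsUniversalMeasuring a)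
    (hone : η[P] ▷ H ≫ a = (λ_ H).hom ≫ ε[H] ≫ η[B]) (hmul : μ[P] ▷ H ≫ a = measProd a a)
    (hH : IsHopf H) : IsHopf P := by
  obtain ⟨s, hs, hs'⟩ := hH
  -- Bundling `s` gives access to the fact that an antipode reverses multiplication, as
  -- `IsMeasuring.cop` requires.
  let _ : HopfObj H := { antipode := s, antipode_left := hs, antipode_right := hs' }
  obtain ⟨f, ⟨hf, hfa⟩, -⟩ := @IsUniversalMeasuring.existsUnique _ _ _ _ _ _ _ _ _ _ _ ha P
    (copComonObj P) _ (ha.isMeasuring.cop (HopfObj.one_antipode H) (HopfObj.mul_antipode H))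
  have hf_counit : f ≫ ε[P] = ε[P] := hf.hom_counit
  have hf_comul : f ≫ Δ[P] = Δ[P] ≫ (β_ P P).hom ≫ (f ⊗ₘ f) := by
    rw [← Category.assoc]
    exact hf.hom_comul
  exact ⟨f, ha.comul_antipode_left hone hmul hf_counit hf_comul hs hfa,
    ha.comul_antipode_right hone hmul hf_counit hf_comul hs' hfa⟩

end Hopf

/-! ### The op-Hopf case and the bimonoid theorem -/

section OpHopf

variable {V : Type w} [Category.{v} V] [MonoidalCategory V] [SymmetricCategory V]
  {B H P : V} [MonObj B]

lemma isOpHopf_iff (H : V) [BimonObj H] : IsOpHopf H ↔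
    ∃ s : H ⟶ H, (Δ[H] ≫ (β_ H H).hom) ≫ s ▷ H ≫ μ[H] = ε[H] ≫ η[H] ∧
      (Δ[H] ≫ (β_ H H).hom) ≫ H ◁ s ≫ μ[H] = ε[H] ≫ η[H] := by
  simp only [IsOpHopf, ← SymmetricCategory.braiding_swap_eq_inv_braiding, Category.assoc]

lemma braiding_whiskerRight_measProd [IsCommMonObj B] [BimonObj H] (a : P ⊗ H ⟶ B) :
    (β_ P P).hom ▷ H ≫ measProd a a =
      (P ⊗ P) ◁ (Δ[H] ≫ (β_ H H).hom) ≫ tensorPairing a a ≫ μ[B] := by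
  rw [measProd, ← whisker_exchange_assoc, whiskerLeft_comp_assoc,
    whiskerLeft_braiding_tensorPairing]

/-- Naturality moves the braiding from the multiplication to the comultiplication, exchanging the
left and right antipode identities. -/
lemma isOpHopf_of_isHopf (b b' : BimonObj P) (h : b'.toComonObj = b.toComonObj)
    (hone : b'.one = b.one) (hmul : b'.mul = (β_ P P).hom ≫ b.mul) (hb' : @IsHopf _ _ _ _ P b') :
    @IsOpHopf _ _ _ _ P b := by
  obtain @⟨m, c⟩ := b
  obtain @⟨m', c'⟩ := b'
  change c' = c at h
  change m'.one = m.one at hone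
  change m'.mul = _ ≫ m.mul at hmul
  subst h
  obtain ⟨f, hf, hf'⟩ := hb'
  rw [hone, hmul] at hf hf'
  rw [BraidedCategory.braiding_naturality_left_assoc] at hf
  rw [BraidedCategory.braiding_naturality_right_assoc] at hf'
  refine ⟨f, ?_, ?_⟩ <;> rw [← SymmetricCategory.braiding_swap_eq_inv_braiding]
  · exact hf'
  · exact hf

lemma IsUniversalMeasuring.bimonObj_mul_eq_braiding [MonObj H] [cP : ComonObj P] {a : P ⊗ H ⟶ B}
    (ha : IsUniversalMeasuring a) (b b' : BimonObj P) (hb : b.toComonObj = cP)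
    (hb' : b'.toComonObj = cP) (h : b.mul ▷ H ≫ a = (β_ P P).hom ▷ H ≫ b'.mul ▷ H ≫ a) :
    b.mul = (β_ P P).hom ≫ b'.mul := by
  have := isComonHom_bimonObj_mul b hb
  have := isComonHom_bimonObj_mul b' hb'
  have := isComonHom_braiding P P
  exact ha.hom_ext _ _ (by rw [h, comp_whiskerRight_assoc])

variable [MonoidalClosed V] [Limits.HasCoequalizers V]

lemma IsUniversalMeasuring.isOpHopf [IsCommMonObj B] [BimonObj H] [bP : BimonObj P] {a : P ⊗ H ⟶ B}
    (ha : IsUniversalMeasuring a)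
    (hone : η[P] ▷ H ≫ a = (λ_ H).hom ≫ ε[H] ≫ η[B]) (hmul : μ[P] ▷ H ≫ a = measProd a a)
    (hH : IsOpHopf H) : IsOpHopf P := by
  have hH' : @IsHopf _ _ _ _ H (copBimonObj H) := (isOpHopf_iff H).1 hH
  have hcop := braiding_whiskerRight_measProd a
  rw [← hmul] at hcop
  -- Universality of `a` involves only the monoid `H`, so `P` is also universal for `H` with
  -- opposite comultiplication. The bimonoid structure `b` so induced has the opposite
  -- multiplication.
  obtain ⟨b, hb, hone', hmul'⟩ := @IsUniversalMeasuring.exists_bimonObj _ _ _ _ _ _ _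
    (copBimonObj H) _ _ _ _ ha
  have ha' : @IsUniversalMeasuring _ _ _ _ H B P _ _ b.toComonObj a := hb.symm ▸ ha
  refine isOpHopf_of_isHopf _ b hb ?_ ?_ (@IsUniversalMeasuring.isHopf _ _ _ _ _ _ _ _
    (copBimonObj H) b _ _ _ _ ha' hone' hmul' hH')
  · exact @IsUniversalMeasuring.bimonObj_one_eq _ _ _ _ _ _ _ _ _ bP.toComonObj _ ha b bP hb rfl
      (hone'.trans hone.symm)
  · exact @IsUniversalMeasuring.bimonObj_mul_eq_braiding _ _ _ _ _ _ _ _ _ bP.toComonObj _ ha b bP hb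
      rfl (hmul'.trans hcop.symm)

/-- A universal measuring comonoid from a bimonoid to a commutative monoid is a bimonoid in a unique
compatible way, and it inherits (op-)antipodes. -/
theorem IsUniversal.exists_isInducedBimonoid [IsCommMonObj B] [BimonObj H] [cP : ComonObj P]
    {e : H ⟶ (ihom P).obj B} (he : IsUniversal H B P e) :
    ∃ b : BimonObj P, IsInducedBimonoid H B P e b ∧
      (∀ b' : BimonObj P, IsInducedBimonoid H B P e b' → b' = b) ∧
      (IsHopf H → IsHopf P) ∧ (IsOpHopf H → IsOpHopf P) := by
  have ha := (isUniversal_iff e).1 he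
  obtain ⟨b, hb, hone, hmul⟩ := ha.exists_bimonObj
  refine ⟨b, (isInducedBimonoid_iff e b).2 ⟨hb, hone, hmul⟩, fun b' h => ?_, ?_, ?_⟩
  · obtain ⟨hb', hone', hmul'⟩ := (isInducedBimonoid_iff e b').1 h
    exact ha.bimonObj_ext _ _ hb' hb (hone'.trans hone.symm) (hmul'.trans hmul.symm)
  · subst hb
    exact ha.isHopf hone hmul
  · subst hb
    exact ha.isOpHopf hone hmul

end OpHopf

/-! ### Existence of universal measuring comonoids of graded vector spaces -/

/-- A split subobject through which the comultiplication factors is a subcomonoid. -/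
lemma exists_comonObj_of_retract {V : Type w} [Category.{v} V] [MonoidalCategory V] {C D : V}
    [ComonObj C] (i : D ⟶ C) (r : C ⟶ D) (hir : i ≫ r = 𝟙 D)
    (h : i ≫ Δ[C] ≫ (r ≫ i ⊗ₘ r ≫ i) = i ≫ Δ[C]) : ∃ _ : ComonObj D, IsComonHom i := by
  have hδ : (i ≫ Δ[C] ≫ (r ⊗ₘ r)) ≫ (i ⊗ₘ i) = i ≫ Δ[C] := by
    rw [Category.assoc, Category.assoc, tensorHom_comp_tensorHom, h]
  let δ := i ≫ Δ[C] ≫ (r ⊗ₘ r)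
  have hδ : δ ≫ (i ⊗ₘ i) = i ≫ Δ[C] := hδ
  clear_value δ
  -- The comonoid laws of `D` are checked in tensor powers of `C`, so the tensored inclusions must
  -- be mono; being split, they are.
  have : IsSplitMono i := ⟨⟨⟨r, hir⟩⟩⟩
  have : Mono (𝟙_ V ◁ i) := inferInstanceAs (Mono ((tensorLeft (𝟙_ V)).map i))
  have : Mono (i ▷ 𝟙_ V) := inferInstanceAs (Mono ((tensorRight (𝟙_ V)).map i))
  have : Mono (i ⊗ₘ (i ⊗ₘ i)) := by
    have : IsSplitMono (i ⊗ₘ (i ⊗ₘ i)) := ⟨⟨⟨r ⊗ₘ (r ⊗ₘ r), by simp [hir]⟩⟩⟩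
    infer_instance
  let _ : ComonObj D :=
    { counit := i ≫ ε[C]
      comul := δ
      counit_comul := by
        rw [← cancel_mono (𝟙_ V ◁ i), comp_whiskerRight, Category.assoc, Category.assoc,
          ← whisker_exchange, ← MonoidalCategory.tensorHom_def_assoc, reassoc_of% hδ,
          ComonObj.counit_comul, leftUnitor_inv_naturality]
      comul_counit := by
        rw [← cancel_mono (i ▷ 𝟙_ V), whiskerLeft_comp, Category.assoc, Category.assoc,
          whisker_exchange, ← MonoidalCategory.tensorHom_def'_assoc, reassoc_of% hδ,
          ComonObj.comul_counit, rightUnitor_inv_naturality]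
      comul_assoc := by
        rw [← cancel_mono (i ⊗ₘ (i ⊗ₘ i))]
        simp only [Category.assoc]
        rw [← associator_naturality, ← tensorHom_id, ← id_tensorHom, tensorHom_comp_tensorHom,
          tensorHom_comp_tensorHom_assoc, hδ, Category.id_comp, ← Category.comp_id i,
          ← tensorHom_comp_tensorHom, ← tensorHom_comp_tensorHom_assoc, Category.comp_id,
          reassoc_of% hδ, reassoc_of% hδ, id_tensorHom, tensorHom_id, ComonObj.comul_assoc] }
  exact ⟨inferInstance, rfl, hδ.symm⟩

end Measuring

/-! ### Quotients, coequalizers and coproducts of graded vector spaces -/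

namespace GrVect

open Measuring

universe u

variable {k : Type u} [Field k]

lemma hom_ext_apply {X Y : GrVect k} {f g : X ⟶ Y} (h : ∀ n (x : X n), (f n).hom x = (g n).hom x) :
    f = g := by
  ext n x
  exact h n x

lemma comp_hom_apply {X Y Z : GrVect k} (f : X ⟶ Y) (g : Y ⟶ Z) (n : ℤ) (x : X n) :
    ((f ≫ g) n).hom x = (g n).hom ((f n).hom x) := rfl

/-- The quotient of a graded vector space by a graded subspace. -/
def quotient (X : GrVect k) (N : ∀ n, Submodule k (X n)) : GrVect k :=
  fun n => ModuleCat.of k (X n ⧸ N n)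

/-- The projection onto a quotient. -/
def mkQ (X : GrVect k) (N : ∀ n, Submodule k (X n)) : X ⟶ quotient X N :=
  fun n => ModuleCat.ofHom (N n).mkQ

/-- The morphism induced on a quotient. -/
def liftQ {X Y : GrVect k} (N : ∀ n, Submodule k (X n)) (f : X ⟶ Y)
    (h : ∀ n, N n ≤ LinearMap.ker (f n).hom) : quotient X N ⟶ Y :=
  fun n => ModuleCat.ofHom ((N n).liftQ (f n).hom (h n))

lemma mkQ_liftQ {X Y : GrVect k} (N : ∀ n, Submodule k (X n)) (f : X ⟶ Y)
    (h : ∀ n, N n ≤ LinearMap.ker (f n).hom) : mkQ X N ≫ liftQ N f h = f :=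
  hom_ext_apply fun _ _ => rfl

lemma mkQ_surjective (X : GrVect k) (N : ∀ n, Submodule k (X n)) (n : ℤ) :
    Function.Surjective (mkQ X N n).hom :=
  (N n).mkQ_surjective

lemma cancel_of_surjective {X Y Z : GrVect k} {f : X ⟶ Y}
    (hf : ∀ n, Function.Surjective (f n).hom) {g g' : Y ⟶ Z} (h : f ≫ g = f ≫ g') : g = g' := by
  refine hom_ext_apply fun n y => ?_
  obtain ⟨x, rfl⟩ := hf n y
  rw [← comp_hom_apply, h, comp_hom_apply]

/-- The projection to the cokernel and the zero morphism agree after `f`, hence are equal. -/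
lemma surjective_of_epi {X Y : GrVect k} (f : X ⟶ Y) [Epi f] (n : ℤ) :
    Function.Surjective (f n).hom := by
  let N : ∀ n, Submodule k (Y n) := fun n => LinearMap.range (f n).hom
  let z : Y ⟶ quotient Y N := fun n => 0
  have h : mkQ Y N = z := by
    rw [← cancel_epi f]
    refine hom_ext_apply fun n x => ?_
    exact (Submodule.Quotient.mk_eq_zero _).2 ⟨x, rfl⟩
  intro y
  exact (Submodule.Quotient.mk_eq_zero (N n)).1 (congrArg (fun g => (g n).hom y) h)

/-- A morphism vanishing on the kernel of a surjection factors through it. -/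
lemma exists_comp_eq_of_ker_le {X Y Z : GrVect k} (f : X ⟶ Y)
    (hf : ∀ n, Function.Surjective (f n).hom) (g : X ⟶ Z)
    (h : ∀ n, LinearMap.ker (f n).hom ≤ LinearMap.ker (g n).hom) : ∃ g' : Y ⟶ Z, f ≫ g' = g := by
  refine ⟨fun n => ModuleCat.ofHom (((LinearMap.ker (f n).hom).liftQ (g n).hom (h n)).comp
    ((f n).hom.quotKerEquivOfSurjective (hf n)).symm.toLinearMap), hom_ext_apply fun n x => ?_⟩
  have : ((f n).hom.quotKerEquivOfSurjective (hf n)).symm ((f n).hom x) =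
      Submodule.Quotient.mk x :=
    (LinearEquiv.symm_apply_eq _).2 rfl
  exact congrArg ((LinearMap.ker (f n).hom).liftQ (g n).hom (h n)) this

instance : Limits.HasCoequalizers (GrVect k) := by
  refine @Limits.hasCoequalizers_of_hasColimit_parallelPair _ _ fun {X Y f g} => ?_
  let N : ∀ n, Submodule k (Y n) := fun n => LinearMap.range ((f n).hom - (g n).hom)
  have w : f ≫ mkQ Y N = g ≫ mkQ Y N := hom_ext_apply fun n x =>
    (Submodule.Quotient.eq (N n)).2 ⟨x, rfl⟩
  have hN {Z : GrVect k} (h : Y ⟶ Z) (w : f ≫ h = g ≫ h) (n : ℤ) :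
      N n ≤ LinearMap.ker (h n).hom := by
    rintro _ ⟨x, rfl⟩
    rw [LinearMap.mem_ker, LinearMap.sub_apply, map_sub, sub_eq_zero]
    exact congrArg (fun φ => (φ n).hom x) w
  exact ⟨⟨_, Limits.Cofork.IsColimit.mk (Limits.Cofork.ofπ (mkQ Y N) w)
    (fun s => liftQ N s.π (hN s.π s.condition)) (fun s => mkQ_liftQ _ _ _)
    fun s m hm => cancel_of_surjective (mkQ_surjective Y N) (hm.trans (mkQ_liftQ _ _ _).symm)⟩⟩

/-- The coproduct of a family of graded vector spaces. -/
def coprod {J : Type u} (X : J → GrVect k) : GrVect k := fun n => ∐ fun j => X j n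

/-- The inclusion of a summand. -/
def coprodInj {J : Type u} (X : J → GrVect k) (j : J) : X j ⟶ coprod X :=
  fun n => Limits.Sigma.ι (fun j => X j n) j

lemma coprod_hom_ext {J : Type u} {X : J → GrVect k} {Y : GrVect k} {f g : coprod X ⟶ Y}
    (h : ∀ j, coprodInj X j ≫ f = coprodInj X j ≫ g) : f = g := by
  ext n : 1
  exact Limits.Sigma.hom_ext _ _ fun j => congrFun (h j) n

lemma exists_coprodDesc {J : Type u} {X : J → GrVect k} {Y : GrVect k} (f : ∀ j, X j ⟶ Y) :
    ∃ g : coprod X ⟶ Y, ∀ j, coprodInj X j ≫ g = f j :=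
  ⟨fun n => Limits.Sigma.desc fun j => f j n, fun j => by
    ext n : 1
    exact Limits.Sigma.ι_desc (fun j => f j n) j⟩

/-! #### Comonoids with a measuring -/

attribute [local instance] ComonObj.instTensorUnit

variable {A B : GrVect k} [MonObj A] [MonObj B]

variable (A B) in
/-- A comonoid together with a measuring from `A` to `B`. -/
structure Meas where
  /-- The underlying object. -/
  X : GrVect k
  [comonObj : ComonObj X]
  /-- The measuring. -/
  a : X ⊗ A ⟶ B
  isMeasuring : IsMeasuring a

attribute [instance] Meas.comonObj

namespace Meas

/-- Comonoid morphisms compatible with the measurings. -/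
structure IsHom (C D : Meas A B) (f : C.X ⟶ D.X) : Prop where
  isComonHom : IsComonHom f
  comp : f ▷ A ≫ D.a = C.a

lemma IsHom.trans {C D E : Meas A B} {f : C.X ⟶ D.X} {g : D.X ⟶ E.X} (hf : IsHom C D f)
    (hg : IsHom D E g) : IsHom C E (f ≫ g) where
  isComonHom := by
    have := hf.1
    have := hg.1
    infer_instance
  comp := by rw [comp_whiskerRight_assoc, hg.2, hf.2]

lemma exists_coprod {J : Type u} (C : J → Meas A B) :
    ∃ (W : Meas A B) (p : ∀ j, (C j).X ⟶ W.X), ∀ j, IsHom (C j) W (p j) := by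
  obtain ⟨c, q, h1, h2, h3⟩ := exists_comonObj_of_jointly_epi
    (fun j => coprodInj (fun j => (C j).X) j) (fun _ _ h => coprod_hom_ext h) (fun j => (C j).a)
    (fun j => (C j).isMeasuring) (exists_coprodDesc _) (exists_coprodDesc _) (exists_coprodDesc _)
  exact ⟨⟨_, q, h2⟩, _, fun j => ⟨h1 j, h3 j⟩⟩

/-- A comonoid with a measuring is simple if it has no proper quotients. -/
def IsSimple (Q : Meas A B) : Prop :=
  ∀ (D : Meas A B) (h : Q.X ⟶ D.X), IsHom Q D h → (∀ n, Function.Surjective (h n).hom) →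
    ∀ n, Function.Injective (h n).hom

/-- The coequalizer of two morphisms into `Q` is a quotient of `Q`, so its projection is injective.
-/
lemma IsSimple.hom_eq {Q : Meas A B} (hQ : Q.IsSimple) {C : Meas A B} {f g : C.X ⟶ Q.X}
    (hf : IsHom C Q f) (hg : IsHom C Q g) : f = g := by
  have := hf.1
  have := hg.1
  obtain ⟨c, q, h1, h2, h3⟩ := exists_comonObj_coequalizer Q.isMeasuring f g
    (fun π h => by
      rw [IsComonHom.hom_comul_assoc, IsComonHom.hom_comul_assoc, tensorHom_comp_tensorHom,
        tensorHom_comp_tensorHom, h])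
    (by rw [IsComonHom.hom_counit, IsComonHom.hom_counit]) (by rw [hf.2, hg.2])
  refine hom_ext_apply fun n x => hQ ⟨_, q, h2⟩ _ ⟨h1, h3⟩
    (fun n => surjective_of_epi (Limits.coequalizer.π f g) n) n ?_
  exact congrArg (fun φ => (φ n).hom x) (Limits.coequalizer.condition f g)

lemma exists_simple_quotient (W : Meas A B) :
    ∃ (Q : Meas A B) (π : W.X ⟶ Q.X), IsHom W Q π ∧ Q.IsSimple := by
  -- The supremum runs over subspaces, which form a set, although the quotients `D` do not.
  let N : ∀ n, Submodule k (W.X n) := fun n => sSup {K | ∃ (D : Meas A B) (h : W.X ⟶ D.X),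
    IsHom W D h ∧ (∀ n, Function.Surjective (h n).hom) ∧ K = LinearMap.ker (h n).hom}
  have hN {D : Meas A B} {h : W.X ⟶ D.X} (hh : IsHom W D h)
      (hs : ∀ n, Function.Surjective (h n).hom) (n : ℤ) : LinearMap.ker (h n).hom ≤ N n :=
    le_sSup ⟨D, h, hh, hs, rfl⟩
  -- A morphism that factors through every quotient kills every kernel, hence their sum; the
  -- structure morphisms are of this kind.
  have hN' {Y : GrVect k} (g : W.X ⟶ Y) (hg : ∀ (D : Meas A B) (h : W.X ⟶ D.X), IsHom W D h →
      (∀ n, Function.Surjective (h n).hom) → ∃ g' : D.X ⟶ Y, h ≫ g' = g) :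
      ∃ g' : quotient W.X N ⟶ Y, ∀ _ : Unit, mkQ W.X N ≫ g' = g := by
    refine ⟨liftQ N g fun n => sSup_le ?_, fun _ => mkQ_liftQ _ _ _⟩
    rintro _ ⟨D, h, hh, hs, rfl⟩ x hx
    obtain ⟨g', rfl⟩ := hg D h hh hs
    rw [LinearMap.mem_ker] at hx ⊢
    rw [comp_hom_apply, hx, map_zero]
  have hker (n) : N n = LinearMap.ker (mkQ W.X N n).hom := ((N n).ker_mkQ).symm
  obtain ⟨c, q, h1, h2, h3⟩ := exists_comonObj_of_jointly_epi (J := Unit) (fun _ => mkQ W.X N)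
    (fun _ _ h => cancel_of_surjective (mkQ_surjective W.X N) (h ()))
    (fun _ => W.a) (fun _ => W.isMeasuring)
    (hN' _ fun D h hh hs => by
      obtain ⟨p, hp⟩ := exists_comp_eq_of_ker_le h hs (mkQ W.X N)
        fun n => (hN hh hs n).trans (hker n).le
      have := hh.1
      exact ⟨Δ[D.X] ≫ (p ⊗ₘ p), by
        rw [IsComonHom.hom_comul_assoc, tensorHom_comp_tensorHom, hp]⟩)
    (hN' _ fun D h hh hs => ⟨ε[D.X], hh.1.hom_counit⟩)
    (hN' _ fun D h hh hs => ⟨flipCurry D.a, by rw [comp_flipCurry, hh.2]⟩)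
  refine ⟨⟨_, q, h2⟩, mkQ W.X N, ⟨h1 (), h3 ()⟩, fun D h hh hs n => ?_⟩
  -- A quotient of the quotient is again a quotient of `W`, so its kernel already lies in `N`.
  have h' := hN (IsHom.trans (D := ⟨_, q, h2⟩) ⟨h1 (), h3 ()⟩ hh)
    (fun n => (hs n).comp (mkQ_surjective W.X N n)) n
  refine (injective_iff_map_eq_zero _).2 fun x hx => ?_
  obtain ⟨x, rfl⟩ := mkQ_surjective W.X N n x
  exact (Submodule.Quotient.mk_eq_zero _).2 (h' hx)

end Meas

/-! #### Countably generated subcomonoids -/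

lemma ι_tensorHom_apply {X Y X' Y' : GrVect k} (f : X ⟶ X') (g : Y ⟶ Y') (i j n : ℤ)
    (h : i + j = n) (x : X i) (y : Y j) :
    ((f ⊗ₘ g) n).hom ((GrVect.ι X Y i j n h).hom (x ⊗ₜ y)) =
      (GrVect.ι X' Y' i j n h).hom ((f i).hom x ⊗ₜ (g j).hom y) := by
  have e : GrVect.ι X Y i j n h ≫ (f ⊗ₘ g) n =
      (f i ▷ Y j) ≫ (X' i ◁ g j) ≫ GrVect.ι X' Y' i j n h := by
    rw [MonoidalCategory.tensorHom_def, comp_apply, reassoc_of% ι_whiskerRight, ι_whiskerLeft]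
  exact congrArg (fun φ => φ.hom (x ⊗ₜ y)) e

/-- Every element of `X ⊗ Y` only depends on finitely many homogeneous elements of `X`. -/
lemma exists_finset_tensorHom_apply_eq {X : GrVect k} (n : ℤ) (t : (X ⊗ X : GrVect k) n) :
    ∃ S : Finset (Σ i, X i), ∀ p : X ⟶ X, (∀ s ∈ S, (p s.1).hom s.2 = s.2) →
      ((p ⊗ₘ p) n).hom t = t := by
  classical
  let T : Submodule k ((X ⊗ X : GrVect k) n) :=
    { carrier := {t | ∃ S : Finset (Σ i, X i), ∀ p : X ⟶ X,
        (∀ s ∈ S, (p s.1).hom s.2 = s.2) → ((p ⊗ₘ p) n).hom t = t}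
      zero_mem' := ⟨∅, fun p _ => map_zero _⟩
      add_mem' := by
        rintro t t' ⟨S, hS⟩ ⟨S', hS'⟩
        refine ⟨S ∪ S', fun p hp => ?_⟩
        rw [map_add, hS p fun s hs => hp s (Finset.mem_union_left _ hs),
          hS' p fun s hs => hp s (Finset.mem_union_right _ hs)]
      smul_mem' := by
        rintro c t ⟨S, hS⟩
        exact ⟨S, fun p hp => by rw [map_smul, hS p hp]⟩ }
  -- The elements with the desired property form a subspace containing all pure tensors, so the
  -- projection modulo it vanishes.
  have h : ModuleCat.ofHom T.mkQ = (0 : (X ⊗ X : GrVect k) n ⟶ ModuleCat.of k (_ ⧸ T)) := by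
    refine tensor_ext fun i j hij => ?_
    ext : 1
    refine TensorProduct.ext' fun x y => (Submodule.Quotient.mk_eq_zero T).2
      ⟨{⟨i, x⟩, ⟨j, y⟩}, fun p hp => ?_⟩
    erw [ι_tensorHom_apply]
    rw [hp ⟨i, x⟩ (by simp), hp ⟨j, y⟩ (by simp)]
    rfl
  exact (Submodule.Quotient.mk_eq_zero T).1 (congrArg (fun φ => φ.hom t) h)

/-- A graded vector space of countable dimension in each degree, as a quotient of a standard one. -/
def countableObj (K : ℤ → Submodule k (ℕ →₀ k)) : GrVect k :=
  fun n => ModuleCat.of k ((ℕ →₀ k) ⧸ K n)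

/-- Starting from `x₀`, repeatedly adjoin the finitely many homogeneous elements on which the
comultiplications of the elements found so far depend. The graded span of the resulting countable
set is a subcomonoid. -/
lemma exists_countable_subcomonoid {C : GrVect k} [ComonObj C] (n₀ : ℤ) (x₀ : C n₀) :
    ∃ (K : ℤ → Submodule k (ℕ →₀ k)) (_ : ComonObj (countableObj K)) (i : countableObj K ⟶ C),
      IsComonHom i ∧ x₀ ∈ LinearMap.range (i n₀).hom := by
  classical
  choose S hS using fun s : Σ i, C i => exists_finset_tensorHom_apply_eq s.1 ((Δ[C] s.1).hom s.2)
  let G : ℕ → Set (Σ i, C i) := fun m =>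
    Nat.rec {⟨n₀, x₀⟩} (fun _ T => T ∪ ⋃ s ∈ T, (S s : Set (Σ i, C i))) m
  have hG (m) : (G m).Countable := by
    induction m with
    | zero => exact Set.countable_singleton _
    | succ m ih => exact ih.union (ih.biUnion fun s _ => (S s).countable_toSet)
  obtain ⟨e, he⟩ := (Set.countable_iUnion hG).exists_eq_range
    ⟨⟨n₀, x₀⟩, Set.mem_iUnion.2 ⟨0, rfl⟩⟩
  have hSe (m : ℕ) (s) (hs : s ∈ S (e m)) : ∃ l, e l = s := by
    obtain ⟨j, hj⟩ := Set.mem_iUnion.1 (he.ge ⟨m, rfl⟩)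
    exact he.le (Set.mem_iUnion.2 ⟨j + 1, Or.inr (Set.mem_biUnion hj hs)⟩)
  -- In each degree the enumeration is padded by zero, so that every degree has generators indexed
  -- by `ℕ`.
  let v : ∀ n, ℕ → C n := fun n m => if h : (e m).1 = n then h ▸ (e m).2 else 0
  have hv (m) : v (e m).1 m = (e m).2 := dif_pos rfl
  let φ : ∀ n, (ℕ →₀ k) →ₗ[k] C n := fun n => Finsupp.linearCombination k (v n)
  let K : ℤ → Submodule k (ℕ →₀ k) := fun n => LinearMap.ker (φ n)
  let i : countableObj K ⟶ C := fun n => ModuleCat.ofHom ((K n).liftQ (φ n) le_rfl)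
  have hi (n) : LinearMap.ker (i n).hom = ⊥ := (K n).ker_liftQ_eq_bot _ _ le_rfl
  -- Over a field the inclusion of the span has a linear retraction; `r ≫ i` fixes the span, hence
  -- also the comultiplications of the generators.
  choose r' hr' using fun n => (i n).hom.exists_leftInverse_of_injective (hi n)
  let r : C ⟶ countableObj K := fun n => ModuleCat.ofHom (r' n)
  have hir : i ≫ r = 𝟙 _ := hom_ext_apply fun n x => LinearMap.congr_fun (hr' n) x
  have hsingle (n m) : (i n).hom (Submodule.Quotient.mk (Finsupp.single m 1)) = v n m :=
    (Finsupp.linearCombination_single k 1 m).trans (one_smul k _)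
  have hfix (l) : ((r ≫ i) (e l).1).hom (e l).2 = (e l).2 := by
    have h : i ≫ r ≫ i = i := by rw [← Category.assoc, hir, Category.id_comp]
    rw [← hv, ← hsingle]
    exact congrArg (fun φ => (φ (e l).1).hom (Submodule.Quotient.mk (Finsupp.single l 1))) h
  have h : i ≫ Δ[C] ≫ (r ≫ i ⊗ₘ r ≫ i) = i ≫ Δ[C] := by
    ext n : 1
    ext : 1
    refine Submodule.linearMap_qext _ (Finsupp.lhom_ext' fun m => LinearMap.ext_ring ?_)
    change (((r ≫ i) ⊗ₘ (r ≫ i)) n).hom ((Δ[C] n).hom ((i n).hom (Submodule.Quotient.mk _))) =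
      (Δ[C] n).hom ((i n).hom (Submodule.Quotient.mk _))
    erw [hsingle]
    by_cases hm : (e m).1 = n
    · subst hm
      rw [hv]
      refine hS (e m) _ fun s hs => ?_
      obtain ⟨l, rfl⟩ := hSe m s hs
      exact hfix l
    · rw [show v n m = 0 from dif_neg hm, map_zero, map_zero]
  obtain ⟨c, hc⟩ := exists_comonObj_of_retract i r hir h
  refine ⟨K, c, i, hc, ?_⟩
  obtain ⟨m, hm⟩ := he.le (Set.mem_iUnion.2 ⟨0, rfl⟩ : (⟨n₀, x₀⟩ : Σ i, C i) ∈ _)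
  refine ⟨Submodule.Quotient.mk (Finsupp.single m 1), ?_⟩
  erw [hsingle]
  have := hv m
  rw [hm] at this
  exact this

/-! ### The terminal measuring comonoid -/

open Meas

variable (A B) in
-- `P` is a simple quotient of the coproduct of all countable objects. Given `C`, let `Q` be a
-- simple quotient of the coproduct of `P` and `C`. The morphism `P ⟶ Q` is an isomorphism, so `C ⟶
-- Q` yields `C ⟶ P`; simplicity of `P` makes it unique.
lemma exists_isUniversalMeasuring :
    ∃ (P : GrVect k) (_ : ComonObj P) (a : P ⊗ A ⟶ B), IsUniversalMeasuring a := by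
  -- Presenting countable objects as quotients of one fixed space keeps the index type in universe
  -- `u`, where coproducts exist.
  let J := Σ (K : ℤ → Submodule k (ℕ →₀ k)) (c : ComonObj (countableObj K)),
    {a : countableObj K ⊗ A ⟶ B // @IsMeasuring _ _ _ _ _ _ _ c _ _ a}
  let D : J → Meas A B := fun j => @Meas.mk _ _ A B _ _ (countableObj j.1) j.2.1 j.2.2.1 j.2.2.2
  obtain ⟨W, inj, hinj⟩ := exists_coprod D
  obtain ⟨P, π, hπ, hP⟩ := W.exists_simple_quotient
  refine ⟨P.X, inferInstance, P.a, P.isMeasuring, fun C _ b hb => ?_⟩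
  obtain ⟨E, p, hp⟩ := exists_coprod (J := ULift.{u} Bool)
    fun t => if t.down then P else ⟨C, b, hb⟩
  obtain ⟨Q, ρ, hρ, hQ⟩ := E.exists_simple_quotient
  obtain ⟨α, hα⟩ : ∃ α, IsHom P Q α := ⟨_, (hp ⟨true⟩).trans hρ⟩
  obtain ⟨f, hf⟩ : ∃ f, IsHom ⟨C, b, hb⟩ Q f := ⟨_, (hp ⟨false⟩).trans hρ⟩
  -- Each `y` lies in a countable subcomonoid of `Q`. Its inclusion and its route through `W` and
  -- `P` agree because `Q` is simple, so `y` comes from `P`.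
  have hsurj (n) : Function.Surjective (α n).hom := fun y => by
    obtain ⟨K, c, i, hi, x, hx⟩ := exists_countable_subcomonoid n y
    let j : J := ⟨K, c, i ▷ A ≫ Q.a, Q.isMeasuring.precomp i⟩
    have hi' : IsHom (D j) Q i := ⟨hi, rfl⟩
    have := hQ.hom_eq (((hinj j).trans hπ).trans hα) hi'
    exact ⟨((inj j ≫ π) n).hom x, by rw [← comp_hom_apply, this, hx]⟩
  have hinj' := hP Q α hα hsurj
  obtain ⟨α', h1⟩ := exists_comp_eq_of_ker_le α hsurj (𝟙 P.X) fun n => by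
    rw [LinearMap.ker_eq_bot.2 (hinj' n)]
    exact bot_le
  have h2 : α' ≫ α = 𝟙 Q.X := cancel_of_surjective hsurj (by rw [reassoc_of% h1, Category.comp_id])
  have hinv (i : P.X ≅ Q.X) (_ : IsComonHom i.hom) : IsComonHom i.inv := inferInstance
  have hα' : IsHom Q P α' :=
    ⟨hinv ⟨α, α', h1, h2⟩ hα.1, by
      rw [← hα.2, ← comp_whiskerRight_assoc, h2, id_whiskerRight, Category.id_comp]⟩
  have hg := hf.trans hα'
  exact ⟨f ≫ α', ⟨hg.1, hg.2⟩, fun g hg' => hP.hom_eq (C := ⟨C, b, hb⟩) ⟨hg'.1, hg'.2⟩ hg⟩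

variable (A B) in
/-- Universal measuring comonoids of graded vector spaces exist. -/
theorem exists_isUniversal :
    ∃ (P : GrVect k) (_ : ComonObj P) (e : A ⟶ (ihom P).obj B), IsUniversal A B P e := by
  obtain ⟨P, c, a, ha⟩ := exists_isUniversalMeasuring A B
  exact ⟨P, c, curry a, (isUniversal_iff _).2 (by rwa [uncurry_curry])⟩

end GrVect

end

theorem mainTheorem12 {k : Type*} [Field k] (H B : GrVect k)
    [CategoryTheory.BimonObj H] [CategoryTheory.MonObj B] [CategoryTheory.IsCommMonObj B] :
    -- the universal measuring comonoid `P(H, B)` exists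
    (∃ (P : GrVect k) (_ : CategoryTheory.ComonObj P)
      (e : H ⟶ (CategoryTheory.ihom P).obj B), Measuring.IsUniversal H B P e) ∧
    -- it carries a unique induced bimonoid structure, which is (op-)Hopf if `H` is
    ∀ (P : GrVect k) [CategoryTheory.ComonObj P] (e : H ⟶ (CategoryTheory.ihom P).obj B),
      Measuring.IsUniversal H B P e →
        ∃ b : CategoryTheory.BimonObj P,
          Measuring.IsInducedBimonoid H B P e b ∧
          (∀ b' : CategoryTheory.BimonObj P, Measuring.IsInducedBimonoid H B P e b' → b' = b) ∧
          (Measuring.IsHopf H → Measuring.IsHopf P) ∧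
          (Measuring.IsOpHopf H → Measuring.IsOpHopf P) := by
  exact ⟨GrVect.exists_isUniversal H B, fun P _ e he => he.exists_isInducedBimonoid⟩
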